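/- Let $n,m\ge 0$ be integers, $A\in\mathbb{R}^{n\times n}$, $B\in\mathbb{R}^{n\times m}$, and let $Q:\mathbb{R}\to\mathcal{S}_+^{n+m}$ be a function with values in the symmetric positive semidefinite real $(n+m)\times(n+m)$ matrices whose entries are piecewise real analytic. Here a function on $\mathbb{R}$ is called piecewise real analytic (respectively piecewise continuous) if there is a set of break points, finite in every bounded interval, off which it is real analytic (respectively continuous); in the analytic case it is moreover required that on each side of a break point the function coincides near that point with a function that is real analytic at the point. Values at break points are arbitrary. A differential equation $\frac{\mathrm d}{\mathrm dt}E(f)=L(f)$, with $E,L$ linear and $f$ piecewise continuous, is understood in integrated form: $L(f)$ is integrable on bounded intervals and $E(f(t))-E(f(t_0))=\int_{t_0}^{t}L(f(\tau))\,\mathrm d\tau$ for all $t,t_0\in\mathbb{R}$. Then the following are equivalent: (i) $Q$ satisfies on $\mathbb{R}$ $$\frac{\mathrm d}{\mathrm dt}\begin{pmatrix} I & 0\end{pmatrix}Q\begin{pmatrix} I\\0\end{pmatrix}=\begin{pmatrix} A & B\end{pmatrix}Q\begin{pmatrix} I\\0\end{pmatrix}+\begin{pmatrix} I & 0\end{pmatrix}Q\begin{pmatrix}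 A^T\\B^T\end{pmatrix}.$$ (ii) There exist $n+m$ piecewise continuous functions $x_i:\mathbb{R}\to\mathbb{R}^n$ and $u_i:\mathbb{R}\to\mathbb{R}^m$, $1\le i\le n+m$, such that $$Q(t)=\sum_{i=1}^{n+m}\begin{pmatrix} x_i(t)\\u_i(t)\end{pmatrix}\begin{pmatrix} x_i(t)^T & u_i(t)^T\end{pmatrix}\quad\text{for all }t\in\mathbb{R},$$ $\dot x_i=Ax_i+Bu_i$ on $\mathbb{R}$ for all $1\le i\le n$, and $x_i=0$ on $\mathbb{R}$ for all $n<i\le n+m$. -/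

import Mathlib

open MeasureTheory Filter Topology

/-- A set of times having only finitely many points in each bounded interval: the admissible
sets of break points of piecewise regular functions on `ℝ`. -/
def LocallyFiniteTimes (D : Set ℝ) : Prop :=
  ∀ a b : ℝ, (D ∩ Set.Icc a b).Finite

/-- `f` is continuous away from a locally finite set of break points. The behaviour at the break
points is not restricted. -/
def PiecewiseContinuous {X : Type*} [TopologicalSpace X] (f : ℝ → X) : Prop :=
  ∃ D : Set ℝ, LocallyFiniteTimes D ∧ ∀ t, t ∉ D → ContinuousAt f t

/-- `f` is real analytic away from a locally finite set of break points, and on each side of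
a break point it coincides with a function that is real analytic at that point: the restriction
of `f` to each of the open pieces extends analytically across the end points of the piece.
The values at the break points themselves are arbitrary. -/
def PiecewiseAnalytic (f : ℝ → ℝ) : Prop :=
  ∃ D : Set ℝ, LocallyFiniteTimes D ∧
    (∀ t, t ∉ D → AnalyticAt ℝ f t) ∧
    (∀ t ∈ D,
      (∃ g : ℝ → ℝ, AnalyticAt ℝ g t ∧ f =ᶠ[𝓝[<] t] g) ∧
      (∃ h : ℝ → ℝ, AnalyticAt ℝ h t ∧ f =ᶠ[𝓝[>] t] h))

/-- The piecewise continuous function `f` satisfies `d/dt E(f) = L(f)` on `ℝ`, i.e.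
`E (f t) - E (f t₀) = ∫_{t₀}^{t} L (f τ) dτ` for all `t₀, t`, the integral of the
vector-valued function being taken coordinatewise. -/
def SolvesODE {X ι : Type*} [TopologicalSpace X] (E L : X → ι → ℝ) (f : ℝ → X) : Prop :=
  PiecewiseContinuous f ∧
    ∀ (k : ι) (t₀ t : ℝ),
      IntervalIntegrable (fun τ => L (f τ) k) volume t₀ t ∧
      E (f t) k - E (f t₀) k = ∫ τ in t₀..t, L (f τ) k

/-- `ẋ = A x + B u` on `ℝ`. -/
def SatisfiesLTI {n m : ℕ} (A : Matrix (Fin n) (Fin n) ℝ) (B : Matrix (Fin n) (Fin m) ℝ)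
    (x : ℝ → Fin n → ℝ) (u : ℝ → Fin m → ℝ) : Prop :=
  SolvesODE (X := (Fin n → ℝ) × (Fin m → ℝ)) (ι := Fin n)
    (fun z => z.1)
    (fun z => A.mulVec z.1 + B.mulVec z.2)
    (fun t => (x t, u t))

/-- `d/dt [(I 0) Q (I 0)ᵀ] = (A B) Q (I 0)ᵀ + (I 0) Q (A B)ᵀ` on `ℝ`. -/
def SatisfiesMatrixDynamics {n m : ℕ} (A : Matrix (Fin n) (Fin n) ℝ)
    (B : Matrix (Fin n) (Fin m) ℝ)
    (Q : ℝ → Matrix (Fin n ⊕ Fin m) (Fin n ⊕ Fin m) ℝ) : Prop :=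
  let J : Matrix (Fin n) (Fin n ⊕ Fin m) ℝ := Matrix.fromCols 1 0
  let F : Matrix (Fin n) (Fin n ⊕ Fin m) ℝ := Matrix.fromCols A B
  SolvesODE (ι := Fin n × Fin n)
    (fun M k => (J * M * J.transpose) k.1 k.2)
    (fun M k => (F * M * J.transpose + J * M * F.transpose) k.1 k.2)
    Q

/-! ### Linear algebra: orthogonal freedom of factors, square roots, block matrices and the gain. -/

section LinearAlgebra

open scoped Matrix MatrixOrder

/-! Write `X`, `Y` for the blocks `Q₁₁`, `Q₂₁`. Positivity gives `ker X ⊆ ker Y`, so some gain `K`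
satisfies `K X = Y`, and (i) becomes the Lyapunov equation `X' = M X + X Mᵀ` with the closed-loop
matrix `M = A + B K`. If `H Hᵀ = X` and `H' = M H`, the columns of `H` are the states and those of
`K H` the inputs of the first `n` trajectories. The block `Q₂₂` exceeds `(K H)(K H)ᵀ = K X Kᵀ` by a
positive semidefinite matrix `R`; the columns of its square root are the inputs of the remaining `m`
trajectories, whose state is zero.

The difficulty is that `K` jumps or blows up where the rank of `X` changes. Analyticity confines
this to a locally finite set: near a point, on either side, each coefficient of the characteristic
polynomial of `X` vanishes identically or nowhere, so the multiplicity of the eigenvalue `0` is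
constant there (`eventually_continuousAt_gain`). Between such points `H` comes from a linear ODE
(`exists_isFactor_of_regular`). At them `K H` stays bounded, because `(K H)(K H)ᵀ ≤ Q₂₂`
(`exists_bound_of_factor`), so `H` extends continuously. Pieces are glued by a constant orthogonal
matrix on the right, which preserves both `H Hᵀ` and `H' = M H`.

Conversely, (i) is the product rule for `∑ xᵢ xᵢᵀ`, since terms with `xᵢ = 0` only enter `Q₂₂`. -/

theorem Matrix.exists_orthogonal_of_mul_transpose_eq {n : ℕ} {H₁ H₂ : Matrix (Fin n) (Fin n) ℝ}
    (h : H₁ * H₁ᵀ = H₂ * H₂ᵀ) :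
    ∃ O : Matrix (Fin n) (Fin n) ℝ, O * Oᵀ = 1 ∧ H₁ = H₂ * O := by
  have hnorm (H : Matrix (Fin n) (Fin n) ℝ) (v : EuclideanSpace ℝ (Fin n)) :
      ‖Matrix.toEuclideanLin Hᵀ v‖ ^ 2 = v.ofLp ⬝ᵥ (H * Hᵀ) *ᵥ v.ofLp := by
    rw [← real_inner_self_eq_norm_sq, EuclideanSpace.inner_eq_star_dotProduct,
      ← Matrix.mulVec_mulVec, Matrix.dotProduct_mulVec]
    simp [Matrix.toEuclideanLin, Matrix.mulVec_transpose]
  -- Equal Gram forms make `H₁ᵀ v ↦ H₂ᵀ v` a well-defined isometry on the range of `H₁ᵀ`; in finite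
  -- dimension it extends to the whole space, and its matrix is `G`.
  have heq (v : EuclideanSpace ℝ (Fin n)) :
      ‖Matrix.toEuclideanLin H₂ᵀ v‖ = ‖Matrix.toEuclideanLin H₁ᵀ v‖ := by
    rw [← sq_eq_sq₀ (norm_nonneg _) (norm_nonneg _), hnorm, hnorm, h]
  set f₁ := Matrix.toEuclideanLin H₁ᵀ
  set f₂ := Matrix.toEuclideanLin H₂ᵀ
  have hker : f₁.ker ≤ f₂.ker := fun v hv => by
    rw [LinearMap.mem_ker, ← norm_eq_zero] at hv ⊢
    rw [heq, hv]
  let l : f₁.range →ₗ[ℝ] EuclideanSpace ℝ (Fin n) :=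
    (f₁.ker.liftQ f₂ hker) ∘ₗ f₁.quotKerEquivRange.symm.toLinearMap
  have hl (v) : l ⟨f₁ v, LinearMap.mem_range_self f₁ v⟩ = f₂ v := by
    have : (⟨f₁ v, LinearMap.mem_range_self f₁ v⟩ : f₁.range)
        = f₁.quotKerEquivRange (Submodule.Quotient.mk v) := by
      ext1; simp
    simp only [l, LinearMap.comp_apply, LinearEquiv.coe_coe]
    rw [this, LinearEquiv.symm_apply_apply]
    simp
  let L : f₁.range →ₗᵢ[ℝ] EuclideanSpace ℝ (Fin n) := ⟨l, by
    rintro ⟨_, v, rfl⟩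
    rw [hl, heq]; rfl⟩
  let G : Matrix (Fin n) (Fin n) ℝ := Matrix.toEuclideanLin.symm L.extend.toLinearMap
  have hG : Matrix.toEuclideanLin G = L.extend.toLinearMap := by simp [G]
  have hGH : G * H₁ᵀ = H₂ᵀ := by
    apply Matrix.toEuclideanLin.injective
    ext1 v
    have h1 : Matrix.toEuclideanLin (G * H₁ᵀ) v = Matrix.toEuclideanLin G (f₁ v) := by
      simp [f₁, Matrix.toEuclideanLin]
    rw [h1, hG]
    have h2 := L.extend_apply ⟨f₁ v, LinearMap.mem_range_self f₁ v⟩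
    exact h2.trans (hl v)
  have hGG : Gᵀ * G = 1 := by
    ext i j
    have h3 := L.extend.inner_map_map (EuclideanSpace.single i 1) (EuclideanSpace.single j 1)
    have h4 (v) : L.extend v = Matrix.toEuclideanLin G v := by rw [hG]; rfl
    rw [h4, h4, EuclideanSpace.inner_eq_star_dotProduct] at h3
    rw [EuclideanSpace.inner_single_left] at h3
    simp only [Matrix.toEuclideanLin, dotProduct, Matrix.toLpLin_apply] at h3
    simp at h3
    rw [Matrix.mul_apply, Matrix.one_apply, ← h3]
    exact Finset.sum_congr rfl fun _ _ => mul_comm _ _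
  refine ⟨G, mul_eq_one_comm.1 hGG, ?_⟩
  have : H₂ = H₁ * Gᵀ := by
    rw [← Matrix.transpose_transpose H₂, ← hGH, Matrix.transpose_mul, Matrix.transpose_transpose]
  rw [this, Matrix.mul_assoc, hGG, Matrix.mul_one]

theorem Matrix.PosSemidef.sqrt_mul_sqrt_transpose {p : Type*} [Fintype p] [DecidableEq p]
    {M : Matrix p p ℝ} (hM : M.PosSemidef) : CFC.sqrt M * (CFC.sqrt M)ᵀ = M := by
  have h := (Matrix.nonneg_iff_posSemidef.1 (CFC.sqrt_nonneg M)).isHermitian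
  rw [Matrix.IsHermitian, Matrix.conjTranspose_eq_transpose_of_trivial] at h
  rw [h, CFC.sqrt_mul_sqrt_self M (Matrix.nonneg_iff_posSemidef.2 hM)]

theorem Matrix.PosSemidef.exists_mul_transpose_eq {p : Type*} [Fintype p] [DecidableEq p]
    {M : Matrix p p ℝ} (hM : M.PosSemidef) : ∃ S : Matrix p p ℝ, S * Sᵀ = M :=
  ⟨_, hM.sqrt_mul_sqrt_transpose⟩

theorem Matrix.isClosed_posSemidef {p : Type*} [Fintype p] :
    IsClosed {M : Matrix p p ℝ | M.PosSemidef} := by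
  simp only [Matrix.posSemidef_iff_dotProduct_mulVec, Set.ofPred_and, Set.ofPred_forall]
  refine IsClosed.inter ?_ (isClosed_iInter fun x => ?_)
  · exact isClosed_eq (by fun_prop) continuous_id
  · exact isClosed_le continuous_const (by fun_prop)

theorem Matrix.sq_le_diag_of_mul_transpose_eq {p q : Type*} [Fintype q]
    {S : Matrix p q ℝ} {M : Matrix p p ℝ} (h : S * Sᵀ = M) (i : p) (j : q) :
    S i j ^ 2 ≤ M i i := by
  rw [← h, Matrix.mul_apply]
  simp only [Matrix.transpose_apply, ← pow_two]
  exact Finset.single_le_sum (f := fun j => S i j ^ 2) (fun _ _ => sq_nonneg _)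
    (Finset.mem_univ j)

/-- Compactness and uniqueness: near `t₀` the roots stay in a bounded box, since their squared
entries are at most diagonal entries of `M t`, and every cluster point is a positive semidefinite
root of `M t₀`. -/
theorem ContinuousAt.matrix_sqrt {p T : Type*} [Fintype p] [DecidableEq p] [TopologicalSpace T]
    {M : T → Matrix p p ℝ} (hM : ∀ t, (M t).PosSemidef) {t₀ : T} (hc : ContinuousAt M t₀) :
    ContinuousAt (fun t => CFC.sqrt (M t)) t₀ := by
  -- The `+ 1` makes the bound on the diagonal strict, hence stable near `t₀`, and gives `B ≤ B ^
  -- 2`, so that `B` also bounds the entries of the root.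
  let B : ℝ := ∑ i, |M t₀ i i| + 1
  have hB (i : p) : |M t₀ i i| < B := by
    have := Finset.single_le_sum (f := fun i => |M t₀ i i|) (fun _ _ => abs_nonneg _)
      (Finset.mem_univ i)
    simp only [B]; linarith
  have hB1 : 1 ≤ B := by
    have := Finset.sum_nonneg (s := Finset.univ) (f := fun i => |M t₀ i i|)
      (fun _ _ => abs_nonneg _)
    simp only [B]; linarith
  have hK : IsCompact (X := Matrix p p ℝ)
      (Set.univ.pi fun _ => Set.univ.pi fun _ => Set.Icc (-B) B) :=
    isCompact_univ_pi fun _ => isCompact_univ_pi fun _ => isCompact_Icc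
  refine hK.tendsto_nhds_of_unique_mapClusterPt ?_ ?_
  · have : ∀ᶠ t in 𝓝 t₀, ∀ i, M t i i < B := by
      refine eventually_all.2 fun i => ?_
      have hci : ContinuousAt (fun t => M t i i) t₀  :=
        ((continuous_apply_apply i i).continuousAt (x := M t₀)).comp hc
      exact hci.eventually_lt_const ((le_abs_self _).trans_lt (hB i))
    filter_upwards [this] with t ht i _ j _
    have h1 := Matrix.sq_le_diag_of_mul_transpose_eq (hM t).sqrt_mul_sqrt_transpose i j
    have h2 := ht i
    rw [Set.mem_Icc, ← abs_le]
    exact abs_le_of_sq_le_sq (by nlinarith) (by linarith)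
  · intro S _ hS
    obtain ⟨U, hU, hUS⟩ := mapClusterPt_iff_ultrafilter.1 hS
    have hpos : S.PosSemidef := Matrix.isClosed_posSemidef.mem_of_tendsto hUS
      (Eventually.of_forall fun t => Matrix.nonneg_iff_posSemidef.1 (CFC.sqrt_nonneg (M t)))
    have hsq : S * S = M t₀ := by
      refine tendsto_nhds_unique (hUS.mul hUS) ?_
      refine Tendsto.congr (fun t => ?_) (hc.mono_left hU)
      exact (CFC.sqrt_mul_sqrt_self (M t) (Matrix.nonneg_iff_posSemidef.2 (hM t))).symm
    exact (CFC.sqrt_unique hsq (Matrix.nonneg_iff_posSemidef.2 hpos)).symm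

/-- A symmetric matrix has no nilpotent part at `0`: `Xᵀ X V = 0` forces `X V = 0`, which lowers the
exponent one step at a time. -/
theorem Matrix.IsSymm.mul_eq_zero_of_pow_mul_eq_zero {p q : Type*} [Fintype p] [DecidableEq p]
    [Fintype q] {X : Matrix p p ℝ} (hX : X.IsSymm) {W : Matrix p q ℝ} :
    ∀ {r : ℕ}, X ^ r * W = 0 → X * W = 0
  | 0, h => by rw [pow_zero, Matrix.one_mul] at h; rw [h, Matrix.mul_zero]
  | 1, h => by rwa [pow_one] at h
  | r + 2, h => by
    refine hX.mul_eq_zero_of_pow_mul_eq_zero (r := r + 1) ?_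
    rw [pow_succ', pow_succ', Matrix.mul_assoc, Matrix.mul_assoc, ← Matrix.mul_assoc X X] at h
    have := (Matrix.conjTranspose_mul_self_mul_eq_zero X (X ^ r * W)).1
    rw [Matrix.conjTranspose_eq_transpose_of_trivial, hX.eq] at this
    rw [pow_succ', Matrix.mul_assoc]
    exact this h

/-- For `V = (W, 0)` the form `Vᵀ Q V` vanishes, and semidefiniteness upgrades this to `Q V = 0`,
whose lower block is the claim. -/
theorem Matrix.PosSemidef.toBlocks₂₁_mul_eq_zero {p q s : Type*} [Fintype p] [Fintype q]
    [DecidableEq p] [DecidableEq q] [Fintype s] {Q : Matrix (p ⊕ q) (p ⊕ q) ℝ}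
    (hQ : Q.PosSemidef) {W : Matrix p s ℝ} (h : Q.toBlocks₁₁ * W = 0) :
    Q.toBlocks₂₁ * W = 0 := by
  let V : Matrix (p ⊕ q) s ℝ := Matrix.fromRows W 0
  have hQV : Q * V = Matrix.fromRows (Q.toBlocks₁₁ * W) (Q.toBlocks₂₁ * W) := by
    conv_lhs => rw [← Matrix.fromBlocks_toBlocks Q]
    simp [V, Matrix.fromBlocks_mul_fromRows]
  have hC := hQ.sqrt_mul_sqrt_transpose
  set C := (CFC.sqrt Q)ᵀ
  have hC' : Cᵀ * C = Q := by rw [Matrix.transpose_transpose, hC]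
  have h0 : (C * V)ᵀ * (C * V) = 0 := by
    rw [Matrix.transpose_mul, Matrix.mul_assoc, ← Matrix.mul_assoc Cᵀ, hC', hQV, h]
    simp [V, Matrix.transpose_fromRows, Matrix.fromCols_mul_fromRows]
  rw [← Matrix.conjTranspose_eq_transpose_of_trivial, Matrix.conjTranspose_mul_self_eq_zero] at h0
  have h1 : Q * V = 0 := by rw [← hC', Matrix.mul_assoc, h0, Matrix.mul_zero]
  rw [hQV] at h1
  ext i j
  exact congrFun (congrFun h1 (Sum.inr i)) j

open Polynomial in
/-- The feedback gain `K = Q₂₁ Q₁₁⁺`, the pseudoinverse of the symmetric matrix `Q₁₁` being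
written on its range as a polynomial in `Q₁₁` with coefficients taken from the characteristic
polynomial of `Q₁₁`, whose root `0` has multiplicity `r`. -/
noncomputable def gainOfOrder {n m : ℕ} (r : ℕ)
    (Q : Matrix (Fin n ⊕ Fin m) (Fin n ⊕ Fin m) ℝ) : Matrix (Fin m) (Fin n) ℝ :=
  (-(Q.toBlocks₁₁.charpoly.coeff r)⁻¹) • (Q.toBlocks₂₁ *
    ∑ k ∈ Finset.range (n + 1), Q.toBlocks₁₁.charpoly.coeff (k + 1 + r) • Q.toBlocks₁₁ ^ k)

/-- The order `r` is split off because `gainOfOrder r` is continuous wherever its leading scalar is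
nonzero; discontinuities of `gain` can only come from changes of `r`. -/
noncomputable def gain {n m : ℕ}
    (Q : Matrix (Fin n ⊕ Fin m) (Fin n ⊕ Fin m) ℝ) : Matrix (Fin m) (Fin n) ℝ :=
  gainOfOrder Q.toBlocks₁₁.charpoly.natTrailingDegree Q

-- Write the characteristic polynomial as `X ^ r * q` with `q(0) ≠ 0`. Cayley–Hamilton and symmetry
-- give `Q₁₁ q(Q₁₁) = 0`, hence `Q₂₁ q(Q₁₁) = 0` by the kernel inclusion; solving for the constant
-- term of `q` yields the identity.
open Polynomial in
theorem Matrix.PosSemidef.gain_mul {n m : ℕ} {Q : Matrix (Fin n ⊕ Fin m) (Fin n ⊕ Fin m) ℝ}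
    (hQ : Q.PosSemidef) : gain Q * Q.toBlocks₁₁ = Q.toBlocks₂₁ := by
  have hsymm : Q.toBlocks₁₁.IsSymm := by
    have := hQ.isHermitian
    rw [Matrix.IsHermitian, Matrix.conjTranspose_eq_transpose_of_trivial] at this
    ext i j
    exact congrFun (congrFun this (Sum.inl i)) (Sum.inl j)
  have hker {W : Matrix (Fin n) (Fin n) ℝ} := hQ.toBlocks₂₁_mul_eq_zero (W := W)
  rw [gain, gainOfOrder]
  set X := Q.toBlocks₁₁
  set Y := Q.toBlocks₂₁
  set c := X.charpoly
  set r := c.natTrailingDegree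
  have hc0 : c ≠ 0 := X.charpoly_monic.ne_zero
  have hcr : c.coeff r ≠ 0 := by
    simpa [r, Polynomial.trailingCoeff] using (Polynomial.trailingCoeff_nonzero_iff_nonzero.2 hc0)
  obtain ⟨q, hq⟩ : (Polynomial.X : ℝ[X]) ^ r ∣ c :=
    Polynomial.X_pow_dvd_iff.2 fun d hd => Polynomial.coeff_eq_zero_of_lt_natTrailingDegree hd
  have hcoeff (k : ℕ) : q.coeff k = c.coeff (k + r) := by
    rw [hq, Polynomial.coeff_X_pow_mul]
  have hdeg : q.divX.natDegree < n + 1 := by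
    rw [Polynomial.natDegree_divX_eq_natDegree_tsub_one]
    have h1 : c.natDegree = n := by rw [X.charpoly_natDegree_eq_dim, Fintype.card_fin]
    have h2 : q.natDegree ≤ c.natDegree :=
      Polynomial.natDegree_le_of_dvd (Dvd.intro_left _ hq.symm) hc0
    omega
  have hS : ∑ k ∈ Finset.range (n + 1), c.coeff (k + 1 + r) • X ^ k = aeval X q.divX := by
    rw [Polynomial.aeval_eq_sum_range' hdeg]
    exact Finset.sum_congr rfl fun k _ => by rw [Polynomial.coeff_divX, hcoeff]
  have hXq : X * aeval X q = 0 := by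
    refine hsymm.mul_eq_zero_of_pow_mul_eq_zero (r := r) ?_
    have := Matrix.aeval_self_charpoly X
    rw [show X.charpoly = c from rfl, hq] at this
    simpa using this
  have hYq : Y * aeval X q = 0 := hker hXq
  have hsplit : aeval X q = aeval X q.divX * X + c.coeff r • 1 := by
    conv_lhs => rw [← Polynomial.divX_mul_X_add q]
    rw [hcoeff, zero_add, map_add, map_mul, Polynomial.aeval_X, Polynomial.aeval_C,
      Algebra.algebraMap_eq_smul_one]
  rw [hsplit, Matrix.mul_add, Matrix.mul_smul, Matrix.mul_one] at hYq
  rw [hS, Matrix.smul_mul, Matrix.mul_assoc, eq_neg_of_add_eq_zero_left hYq, smul_neg, neg_smul,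
    neg_neg, smul_smul, inv_mul_cancel₀ hcr, one_smul]

theorem Matrix.PosSemidef.toBlocks₁₁_posSemidef {p q : Type*}
    {Q : Matrix (p ⊕ q) (p ⊕ q) ℝ} (hQ : Q.PosSemidef) : Q.toBlocks₁₁.PosSemidef :=
  hQ.submatrix Sum.inl

theorem Matrix.PosSemidef.toBlocks₁₂_eq {p q : Type*}
    {Q : Matrix (p ⊕ q) (p ⊕ q) ℝ} (hQ : Q.PosSemidef) : Q.toBlocks₁₂ = Q.toBlocks₂₁ᵀ := by
  have := hQ.isHermitian
  rw [Matrix.IsHermitian, Matrix.conjTranspose_eq_transpose_of_trivial] at this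
  ext i j
  exact (congrFun (congrFun this (Sum.inl i)) (Sum.inr j)).symm

/-- This generalized Schur complement is the compression of `Q` by the row `(-K, 1)`. -/
theorem Matrix.PosSemidef.sub_of_mul_toBlocks₁₁_eq {p q : Type*} [Fintype p] [Fintype q]
    [DecidableEq p] [DecidableEq q] {Q : Matrix (p ⊕ q) (p ⊕ q) ℝ} (hQ : Q.PosSemidef)
    {K : Matrix q p ℝ} (hK : K * Q.toBlocks₁₁ = Q.toBlocks₂₁) :
    (Q.toBlocks₂₂ - K * Q.toBlocks₁₁ * Kᵀ).PosSemidef := by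
  have h := hQ.mul_mul_conjTranspose_same (Matrix.fromCols (-K) 1)
  convert h using 1
  conv_rhs => rw [← Matrix.fromBlocks_toBlocks Q, ← Matrix.fromRows_fromCols_eq_fromBlocks]
  rw [Matrix.conjTranspose_eq_transpose_of_trivial, Matrix.transpose_fromCols,
    Matrix.fromCols_mul_fromRows, Matrix.mul_fromCols, Matrix.mul_fromCols, ← hK, hQ.toBlocks₁₂_eq,
    ← hK]
  simp only [Matrix.add_mul, Matrix.fromCols_mul_fromRows, Matrix.transpose_mul]
  have hs : Q.toBlocks₁₁ᵀ = Q.toBlocks₁₁ := by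
    simpa [Matrix.IsHermitian, Matrix.conjTranspose_eq_transpose_of_trivial]
      using hQ.toBlocks₁₁_posSemidef.isHermitian
  simp [hs, Matrix.mul_assoc]
  abel

end LinearAlgebra

/-! ### Factors of Lyapunov solutions: gluing, local existence, extension to end points. -/

section Factorization

open scoped Matrix Matrix.Norms.Operator NNReal

theorem HasDerivAt.transpose_matrix {n : ℕ} {f : ℝ → Matrix (Fin n) (Fin n) ℝ}
    {f' : Matrix (Fin n) (Fin n) ℝ} {t : ℝ} (h : HasDerivAt f f' t) :
    HasDerivAt (fun t => (f t)ᵀ) f'ᵀ t :=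
  hasDerivAt_pi.2 fun i => hasDerivAt_pi.2 fun j => hasDerivAt_pi.1 (hasDerivAt_pi.1 h j) i

/-- On `[a, b]`, `H` is a continuous factor of `X = H Hᵀ` which solves `H' = M H` off
a countable set. -/
structure IsFactor {n : ℕ} (M X H : ℝ → Matrix (Fin n) (Fin n) ℝ) (a b : ℝ) : Prop where
  continuousOn : ContinuousOn H (Set.Icc a b)
  mul_transpose : ∀ t ∈ Set.Icc a b, H t * (H t)ᵀ = X t
  hasDerivAt : ∃ C : Set ℝ, C.Countable ∧ ∀ t ∈ Set.Ioo a b, t ∉ C → HasDerivAt H (M t * H t) t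

variable {n : ℕ} {M X H H₁ H₂ : ℝ → Matrix (Fin n) (Fin n) ℝ} {a b c : ℝ}

theorem IsFactor.mono (h : IsFactor M X H a b) {a' b' : ℝ} (ha : a ≤ a') (hb : b' ≤ b) :
    IsFactor M X H a' b' where
  continuousOn := h.continuousOn.mono (Set.Icc_subset_Icc ha hb)
  mul_transpose t ht := h.mul_transpose t (Set.Icc_subset_Icc ha hb ht)
  hasDerivAt := by
    obtain ⟨C, hC, hd⟩ := h.hasDerivAt
    exact ⟨C, hC, fun t ht => hd t (Set.Ioo_subset_Ioo ha hb ht)⟩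

theorem IsFactor.congr (h : IsFactor M X H₁ a b) (he : Set.EqOn H₂ H₁ (Set.Icc a b)) :
    IsFactor M X H₂ a b where
  continuousOn := h.continuousOn.congr he
  mul_transpose t ht := by rw [he ht, h.mul_transpose t ht]
  hasDerivAt := by
    obtain ⟨C, hC, hd⟩ := h.hasDerivAt
    refine ⟨C, hC, fun t ht htC => ?_⟩
    rw [he (Set.Ioo_subset_Icc_self ht)]
    refine (hd t ht htC).congr_of_eventuallyEq ?_
    filter_upwards [Icc_mem_nhds ht.1 ht.2] with s hs using he hs

theorem IsFactor.mul_orthogonal (h : IsFactor M X H a b) {O : Matrix (Fin n) (Fin n) ℝ}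
    (hO : O * Oᵀ = 1) : IsFactor M X (fun t => H t * O) a b where
  continuousOn := h.continuousOn.mul continuousOn_const
  mul_transpose t ht := by
    rw [Matrix.transpose_mul, Matrix.mul_assoc, ← Matrix.mul_assoc O, hO, Matrix.one_mul,
      h.mul_transpose t ht]
  hasDerivAt := by
    obtain ⟨C, hC, hd⟩ := h.hasDerivAt
    refine ⟨C, hC, fun t ht htC => ?_⟩
    rw [← Matrix.mul_assoc]
    exact (hd t ht htC).mul_const O

/-- The value of a factor at one time can be prescribed, by a constant orthogonal matrix on the
right. This is what allows gluing. -/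
theorem IsFactor.exists_match (h : IsFactor M X H a b) {t : ℝ} (ht : t ∈ Set.Icc a b)
    {F : Matrix (Fin n) (Fin n) ℝ} (hF : F * Fᵀ = X t) :
    ∃ H', IsFactor M X H' a b ∧ H' t = F := by
  obtain ⟨O, hO, hFO⟩ := Matrix.exists_orthogonal_of_mul_transpose_eq
    (hF.trans (h.mul_transpose t ht).symm)
  exact ⟨_, h.mul_orthogonal hO, hFO.symm⟩

theorem IsFactor.piecewise (h₁ : IsFactor M X H₁ a b) (h₂ : IsFactor M X H₂ b c)
    (hb : H₁ b = H₂ b) : IsFactor M X (fun t => if t ≤ b then H₁ t else H₂ t) a c where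
  continuousOn := by
    refine ContinuousOn.if (fun t ht => ?_) (h₁.continuousOn.mono ?_) (h₂.continuousOn.mono ?_)
    · have : t ∈ frontier (Set.Iic b) := ht.2
      rw [frontier_Iic, Set.mem_singleton_iff] at this
      rw [this, hb]
    · rintro t ⟨ht, htb⟩
      have : t ∈ closure (Set.Iic b) := htb
      rw [closure_Iic] at this
      exact ⟨ht.1, this⟩
    · rintro t ⟨ht, htb⟩
      have h1 : {t | ¬ t ≤ b} = Set.Ioi b := by ext; simp
      rw [h1, closure_Ioi] at htb
      exact ⟨htb, ht.2⟩
  mul_transpose t ht := by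
    split_ifs with h
    · exact h₁.mul_transpose t ⟨ht.1, h⟩
    · exact h₂.mul_transpose t ⟨(not_le.1 h).le, ht.2⟩
  hasDerivAt := by
    obtain ⟨C₁, hC₁, hd₁⟩ := h₁.hasDerivAt
    obtain ⟨C₂, hC₂, hd₂⟩ := h₂.hasDerivAt
    refine ⟨C₁ ∪ C₂ ∪ {b}, (hC₁.union hC₂).union (Set.countable_singleton b), fun t ht htC => ?_⟩
    simp only [Set.mem_union, Set.mem_singleton_iff, not_or] at htC
    rcases lt_or_gt_of_ne htC.2 with h | h
    · rw [if_pos h.le]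
      refine (hd₁ t ⟨ht.1, h⟩ htC.1.1).congr_of_eventuallyEq ?_
      filter_upwards [Iio_mem_nhds h] with s hs
      exact if_pos (le_of_lt hs)
    · rw [if_neg h.not_ge]
      refine (hd₂ t ⟨h, ht.2⟩ htC.1.2).congr_of_eventuallyEq ?_
      filter_upwards [Ioi_mem_nhds h] with s hs
      exact if_neg (not_le.2 hs)

theorem IsFactor.exists_extend_right (hab : a ≤ b) (hbc : b ≤ c) (h₁ : IsFactor M X H₁ a b)
    (h₂ : IsFactor M X H₂ b c) :
    ∃ H, IsFactor M X H a c ∧ Set.EqOn H H₁ (Set.Icc a b) := by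
  obtain ⟨H', h', hb⟩ := h₂.exists_match (Set.left_mem_Icc.2 hbc)
    (h₁.mul_transpose b (Set.right_mem_Icc.2 hab))
  exact ⟨_, h₁.piecewise h' hb.symm, fun t ht => if_pos ht.2⟩

theorem IsFactor.exists_extend_left (hab : a ≤ b) (hbc : b ≤ c) (h₁ : IsFactor M X H₁ a b)
    (h₂ : IsFactor M X H₂ b c) :
    ∃ H, IsFactor M X H a c ∧ Set.EqOn H H₂ (Set.Icc b c) := by
  obtain ⟨H', h', hb⟩ := h₁.exists_match (Set.right_mem_Icc.2 hab)
    (h₂.mul_transpose b (Set.left_mem_Icc.2 hbc))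
  refine ⟨_, h'.piecewise h₂ hb, fun t ht => ?_⟩
  rcases ht.1.eq_or_lt with rfl | h
  · simp [hb]
  · exact if_neg h.not_ge

theorem IsFactor.exists_extend {a' b' : ℝ} (ha : a' ≤ a) (hab : a ≤ b) (hb : b ≤ b')
    (h₁ : IsFactor M X H₁ a b) (h₂ : IsFactor M X H₂ a' b') :
    ∃ H, IsFactor M X H a' b' ∧ Set.EqOn H H₁ (Set.Icc a b) := by
  obtain ⟨F, hF, hF₁⟩ := h₁.exists_extend_right hab hb (h₂.mono (ha.trans hab) le_rfl)
  obtain ⟨G, hG, hGF⟩ := IsFactor.exists_extend_left ha (hab.trans hb)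
    (h₂.mono le_rfl (hab.trans hb)) hF
  exact ⟨G, hG, fun t ht => (hGF ⟨ht.1, ht.2.trans hb⟩).trans (hF₁ ht)⟩

/-- Compactness: a subdivision subordinate to the local intervals reduces the claim to finitely many
concatenations. -/
theorem Real.rel_Icc_of_local {P : ℝ → ℝ → Prop}
    (htrans : ∀ a b c, a ≤ b → b ≤ c → P a b → P b c → P a c)
    (hmono : ∀ a b a' b', P a b → a ≤ a' → b' ≤ b → P a' b') {a b : ℝ} (hab : a ≤ b)
    (hloc : ∀ t ∈ Set.Icc a b, ∃ ε > 0, P (t - ε) (t + ε)) : P a b := by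
  choose! ε hε hP using hloc
  obtain ⟨t, ht0, htm, ⟨N, hN⟩, ht⟩ := exists_monotone_Icc_subset_open_cover_Icc hab
    (c := fun s : Set.Icc a b => {u | (u : ℝ) ∈ Set.Ioo (s - ε s : ℝ) (s + ε s)})
    (fun s => isOpen_Ioo.preimage continuous_subtype_val)
    (fun s _ => Set.mem_iUnion.2 ⟨s, by
      have := hε s s.2
      constructor <;> linarith⟩)
  have hstep (k : ℕ) : P (t k) (t (k + 1)) := by
    obtain ⟨s, hs⟩ := ht k
    have h1 := hs (Set.left_mem_Icc.2 (htm k.le_succ))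
    have h2 := hs (Set.right_mem_Icc.2 (htm k.le_succ))
    exact hmono _ _ _ _ (hP s s.2) h1.1.le h2.2.le
  have hall (k : ℕ) : P (t 0) (t (k + 1)) := by
    induction k with
    | zero => exact hstep 0
    | succ k ih => exact htrans _ _ _ (htm (Nat.zero_le _)) (htm (Nat.le_succ _)) ih (hstep _)
  have := hall N
  rwa [ht0, hN (N + 1) N.le_succ] at this

theorem exists_isFactor_Icc_of_local (hab : a ≤ b)
    (h : ∀ t ∈ Set.Icc a b, ∃ ε > 0, ∃ H, IsFactor M X H (t - ε) (t + ε)) :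
    ∃ H, IsFactor M X H a b := by
  refine Real.rel_Icc_of_local (P := fun a b => ∃ H, IsFactor M X H a b) ?_ ?_ hab h
  · rintro a b c hab hbc ⟨H₁, h₁⟩ ⟨H₂, h₂⟩
    obtain ⟨H, hH, -⟩ := h₁.exists_extend_right hab hbc h₂
    exact ⟨H, hH⟩
  · rintro a b a' b' ⟨H, hH⟩ ha hb
    exact ⟨H, hH.mono ha hb⟩

/-- Each factor is extended to the next interval without being altered on the previous one, so the
sequence stabilizes at every time. -/
theorem exists_isFactor_of_exhaustion {a b : ℕ → ℝ} (ha : Antitone a) (hb : Monotone b)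
    (hab : ∀ k, a k ≤ b k) (h : ∀ k, ∃ H, IsFactor M X H (a k) (b k)) :
    ∃ H, ∀ k, IsFactor M X H (a k) (b k) := by
  have hext (k : ℕ) (F : {H // IsFactor M X H (a k) (b k)}) :
      ∃ G : {H // IsFactor M X H (a (k + 1)) (b (k + 1))},
        Set.EqOn G.1 F.1 (Set.Icc (a k) (b k)) := by
    obtain ⟨H₂, h₂⟩ := h (k + 1)
    obtain ⟨G, hG, he⟩ := F.2.exists_extend (ha k.le_succ) (hab k) (hb k.le_succ) h₂
    exact ⟨⟨G, hG⟩, he⟩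
  choose e he using hext
  obtain ⟨F₀, hF₀⟩ := h 0
  let f : ∀ k, {H // IsFactor M X H (a k) (b k)} := fun k =>
    Nat.rec (motive := fun k => {H // IsFactor M X H (a k) (b k)}) ⟨F₀, hF₀⟩ e k
  have hsub {j k : ℕ} (hjk : j ≤ k) : Set.Icc (a j) (b j) ⊆ Set.Icc (a k) (b k) :=
    Set.Icc_subset_Icc (ha hjk) (hb hjk)
  have hf {j k : ℕ} (hjk : j ≤ k) : Set.EqOn (f k).1 (f j).1 (Set.Icc (a j) (b j)) := by
    induction k, hjk using Nat.le_induction with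
    | base => exact fun _ _ => rfl
    | succ k hjk ih => exact fun t ht => (he k (f k) (hsub hjk ht)).trans (ih ht)
  classical
  refine ⟨fun t => if ht : ∃ k, t ∈ Set.Icc (a k) (b k) then (f (Nat.find ht)).1 t else 0,
    fun k => (f k).2.congr fun t ht => ?_⟩
  have hk : ∃ k, t ∈ Set.Icc (a k) (b k) := ⟨k, ht⟩
  simp only [dif_pos hk]
  exact (hf (Nat.find_min' hk ht) (Nat.find_spec hk)).symm

/-- Solve `H' = M H` from a square root of `X t₀`; then `H Hᵀ` and `X` solve the same linear
Lyapunov equation with the same initial value, so they agree. -/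
theorem exists_isFactor_of_regular {t₀ : ℝ} (hX₀ : (X t₀).PosSemidef)
    (hM : ∀ᶠ t in 𝓝 t₀, ContinuousAt M t)
    (hX : ∀ᶠ t in 𝓝 t₀, HasDerivAt X (M t * X t + X t * (M t)ᵀ) t) :
    ∃ ε > 0, ∃ H, IsFactor M X H (t₀ - ε) (t₀ + ε) := by
  obtain ⟨δ, hδ, hball⟩ := Metric.eventually_nhds_iff_ball.1 (hM.and hX)
  have hcM : ContinuousOn M (Set.Icc (t₀ - δ / 2) (t₀ + δ / 2)) := fun t ht =>
    (hball t (by rw [Real.ball_eq_Ioo]; constructor <;> linarith [ht.1, ht.2])).1.continuousWithinAt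
  have hcMT : ContinuousOn (fun t => (M t)ᵀ) (Set.Icc (t₀ - δ / 2) (t₀ + δ / 2)) :=
    Continuous.comp_continuousOn' (by fun_prop) hcM
  obtain ⟨C₁, hC₁⟩ := isCompact_Icc.exists_bound_of_continuousOn hcM
  obtain ⟨C₂, hC₂⟩ := isCompact_Icc.exists_bound_of_continuousOn hcMT
  let C : ℝ≥0 := Real.toNNReal (max C₁ C₂)
  have hC (t) (ht : t ∈ Set.Icc (t₀ - δ / 2) (t₀ + δ / 2)) : ‖M t‖ ≤ C ∧ ‖(M t)ᵀ‖ ≤ C := by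
    have := Real.le_coe_toNNReal (max C₁ C₂)
    exact ⟨(hC₁ t ht).trans ((le_max_left _ _).trans this),
      (hC₂ t ht).trans ((le_max_right _ _).trans this)⟩
  obtain ⟨S, hS⟩ := hX₀.exists_mul_transpose_eq
  -- `L` bounds the vector field on the unit ball around `S`, and `η ≤ 1 / (L + 1)` keeps the
  -- Picard–Lindelöf solution in that ball.
  let L : ℝ≥0 := C * (‖S‖₊ + 1)
  let η : ℝ := min (δ / 2) (1 / (L + 1))
  have hη : 0 < η := by positivity
  have hηδ : Set.Icc (t₀ - η) (t₀ + η) ⊆ Set.Icc (t₀ - δ / 2) (t₀ + δ / 2) :=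
    Set.Icc_subset_Icc (by linarith [min_le_left (δ / 2) (1 / ((L : ℝ) + 1))])
      (by linarith [min_le_left (δ / 2) (1 / ((L : ℝ) + 1))])
  have ht₀ : t₀ ∈ Set.Icc (t₀ - η) (t₀ + η) := ⟨by linarith, by linarith⟩
  have hPL : IsPicardLindelof (fun t (x : Matrix (Fin n) (Fin n) ℝ) => M t * x)
      (⟨t₀, ht₀⟩ : Set.Icc (t₀ - η) (t₀ + η)) S 1 0 L C := by
    refine ⟨fun t ht => ?_, fun x _ => ?_, fun t ht x hx => ?_, ?_⟩
    · refine (LipschitzWith.of_dist_le_mul fun x y => ?_).lipschitzOnWith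
      rw [dist_eq_norm, dist_eq_norm, ← mul_sub]
      exact (norm_mul_le _ _).trans (mul_le_mul_of_nonneg_right (hC t (hηδ ht)).1 (norm_nonneg _))
    · exact (hcM.mono hηδ).mul continuousOn_const
    · refine (norm_mul_le _ _).trans ?_
      have hx' : ‖x‖ ≤ ‖S‖ + 1 := by
        rw [mem_closedBall_iff_norm] at hx
        have := norm_le_norm_add_norm_sub' x S
        simp at hx
        linarith
      simp only [L, NNReal.coe_mul, NNReal.coe_add, NNReal.coe_one, coe_nnnorm]
      exact mul_le_mul (hC t (hηδ ht)).1 hx' (norm_nonneg _) C.2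
    · have h1 : max (t₀ + η - t₀) (t₀ - (t₀ - η)) = η := by simp
      simp only [h1, NNReal.coe_one, NNReal.coe_zero, sub_zero]
      calc (L : ℝ) * η ≤ L * (1 / (L + 1)) :=
            mul_le_mul_of_nonneg_left (min_le_right _ _) L.2
        _ ≤ 1 := by
          rw [mul_one_div, div_le_one (by positivity)]
          linarith
  obtain ⟨H, hH₀, hH⟩ := hPL.exists_eq_forall_mem_Icc_hasDerivWithinAt₀
  have hHd (t) (ht : t ∈ Set.Ioo (t₀ - η) (t₀ + η)) : HasDerivAt H (M t * H t) t :=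
    (hH t (Set.Ioo_subset_Icc_self ht)).hasDerivAt (Icc_mem_nhds ht.1 ht.2)
  have heq : Set.EqOn X (fun t => H t * (H t)ᵀ) (Set.Ioo (t₀ - η) (t₀ + η)) := by
    refine ODE_solution_unique_of_mem_Ioo (v := fun t P => M t * P + P * (M t)ᵀ)
      (s := fun _ => Set.univ) (K := C + C) (t₀ := t₀) (fun t ht => ?_)
      ⟨by linarith, by linarith⟩ (fun t ht => ⟨?_, trivial⟩) (fun t ht => ⟨?_, trivial⟩) ?_
    · refine (LipschitzWith.of_dist_le_mul fun x y => ?_).lipschitzOnWith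
      rw [dist_eq_norm, dist_eq_norm]
      have hxy : M t * x + x * (M t)ᵀ - (M t * y + y * (M t)ᵀ)
          = M t * (x - y) + (x - y) * (M t)ᵀ := by noncomm_ring
      rw [hxy]
      have hb := hC t (hηδ (Set.Ioo_subset_Icc_self ht))
      refine (norm_add_le _ _).trans ?_
      rw [NNReal.coe_add, add_mul]
      refine add_le_add ((norm_mul_le _ _).trans
        (mul_le_mul_of_nonneg_right hb.1 (norm_nonneg _))) ((norm_mul_le _ _).trans ?_)
      rw [mul_comm]
      exact mul_le_mul_of_nonneg_right hb.2 (norm_nonneg _)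
    · have := hηδ (Set.Ioo_subset_Icc_self ht)
      exact (hball t (by rw [Real.ball_eq_Ioo]; constructor <;> linarith [this.1, this.2])).2
    · have := (hHd t ht).mul (hHd t ht).transpose_matrix
      rwa [Matrix.transpose_mul, Matrix.mul_assoc, ← Matrix.mul_assoc (H t)] at this
    · simp only [hH₀]
      exact hS.symm
  have hsub : Set.Icc (t₀ - η / 2) (t₀ + η / 2) ⊆ Set.Ioo (t₀ - η) (t₀ + η) := fun t ht =>
    ⟨by linarith [ht.1], by linarith [ht.2]⟩
  exact ⟨η / 2, by positivity, H,
    fun t ht => (hHd t (hsub ht)).continuousAt.continuousWithinAt,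
    fun t ht => (heq (hsub ht)).symm,
    ∅, Set.countable_empty, fun t ht _ => hHd t (hsub (Set.Ioo_subset_Icc_self ht))⟩

theorem intervalIntegrable_of_continuousOn_Ioo_of_bounded {E : Type*} [NormedAddCommGroup E]
    {f : ℝ → E} {p q B : ℝ} (hpq : p ≤ q) (hf : ContinuousOn f (Set.Ioo p q))
    (hB : ∀ t ∈ Set.Ioo p q, ‖f t‖ ≤ B) : IntervalIntegrable f volume p q := by
  rw [intervalIntegrable_iff_integrableOn_Ioo_of_le hpq]
  refine ⟨hf.aestronglyMeasurable measurableSet_Ioo, HasFiniteIntegral.of_bounded (C := B) ?_⟩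
  filter_upwards [ae_restrict_mem measurableSet_Ioo] with t ht using hB t ht

theorem exists_continuousOn_Icc_extension_of_bounded_deriv {E : Type*} [NormedAddCommGroup E]
    [NormedSpace ℝ E] [CompleteSpace E] {f f' : ℝ → E} {p q B : ℝ} (hpq : p < q)
    (hf : ContinuousOn f (Set.Ioo p q)) (hf' : ContinuousOn f' (Set.Ioo p q))
    (hB : ∀ t ∈ Set.Ioo p q, ‖f' t‖ ≤ B) {C : Set ℝ} (hC : C.Countable)
    (hd : ∀ t ∈ Set.Ioo p q, t ∉ C → HasDerivAt f (f' t) t) :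
    ∃ g : ℝ → E, ContinuousOn g (Set.Icc p q) ∧ Set.EqOn g f (Set.Ioo p q) := by
  have hint := intervalIntegrable_of_continuousOn_Ioo_of_bounded hpq.le hf' hB
  let r := (p + q) / 2
  have hr : r ∈ Set.Ioo p q := ⟨by simp only [r]; linarith, by simp only [r]; linarith⟩
  refine ⟨fun t => f r + ∫ s in r..t, f' s, ?_, fun t ht => ?_⟩
  · have := intervalIntegral.continuousOn_primitive_interval' hint
      (a := r) (Set.uIcc_of_le hpq.le ▸ Set.Ioo_subset_Icc_self hr)
    rw [Set.uIcc_of_le hpq.le] at this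
    exact continuousOn_const.add this
  · have hsub : Set.uIcc r t ⊆ Set.Ioo p q := Set.ordConnected_Ioo.uIcc_subset hr ht
    have := integral_eq_of_hasDerivAt_off_countable f f' hC
      (a := r) (b := t) (hf.mono hsub)
      (fun s hs => hd s (hsub (Set.Ioo_subset_Icc_self hs.1)) hs.2)
      (hint.mono_set (hsub.trans (Set.Ioo_subset_Icc_self.trans Set.Icc_subset_uIcc)))
    simp only [this, add_sub_cancel]

/-- Here `M` may blow up at `p` and `q`; the bound on `M t * F` over all factors `F` keeps `H'`
bounded, so `H` has limits at both ends. -/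
theorem exists_isFactor_of_Ioo_regular {p q : ℝ} (hpq : p < q)
    (hX : ∀ t, (X t).PosSemidef) (hXc : Continuous X)
    (hM : ∀ t ∈ Set.Ioo p q, ContinuousAt M t)
    (hXd : ∀ t ∈ Set.Ioo p q, HasDerivAt X (M t * X t + X t * (M t)ᵀ) t)
    {B : ℝ} (hB : ∀ t ∈ Set.Ioo p q, ∀ F : Matrix (Fin n) (Fin n) ℝ, F * Fᵀ = X t →
      ‖M t * F‖ ≤ B) :
    ∃ H, IsFactor M X H p q := by
  -- The shift by `2` keeps `[p + d k, q - d k]` nonempty; for `k = 0` it is the midpoint.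
  let d : ℕ → ℝ := fun k => (q - p) / (k + 2)
  have hd0 (k) : 0 < d k := div_pos (sub_pos.2 hpq) (by positivity)
  have hd : Antitone d := fun j k hjk =>
    div_le_div_of_nonneg_left (sub_pos.2 hpq).le (by positivity) (by gcongr)
  have hd2 (k) : d k ≤ (q - p) / 2 :=
    div_le_div_of_nonneg_left (sub_pos.2 hpq).le (by positivity) (by simp)
  have hcover (t) (ht : t ∈ Set.Ioo p q) : ∃ k, t ∈ Set.Ioo (p + d k) (q - d k) := by
    have hm : 0 < min (t - p) (q - t) := lt_min (by linarith [ht.1]) (by linarith [ht.2])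
    obtain ⟨k, hk⟩ := exists_nat_gt ((q - p) / min (t - p) (q - t))
    have : d k < min (t - p) (q - t) := by
      rw [div_lt_iff₀ hm] at hk
      rw [div_lt_iff₀ (by positivity)]
      nlinarith
    have h1 := this.trans_le (min_le_left _ _)
    have h2 := this.trans_le (min_le_right _ _)
    exact ⟨k, by linarith, by linarith⟩
  obtain ⟨H, hH⟩ : ∃ H, ∀ k, IsFactor M X H (p + d k) (q - d k) := by
    refine exists_isFactor_of_exhaustion (fun j k h => by linarith [hd h])
      (fun j k h => by linarith [hd h]) (fun k => by linarith [hd2 k]) fun k => ?_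
    refine exists_isFactor_Icc_of_local (by linarith [hd2 k]) fun t ht => ?_
    have : Set.Ioo p q ∈ 𝓝 t :=
      Ioo_mem_nhds (by linarith [ht.1, hd0 k]) (by linarith [ht.2, hd0 k])
    exact exists_isFactor_of_regular (hX t) (eventually_of_mem this hM)
      (eventually_of_mem this hXd)
  have hHc k := (hH k).continuousOn
  have hHf k := (hH k).mul_transpose
  choose C hC hHd using fun k => (hH k).hasDerivAt
  have hHcont (t) (ht : t ∈ Set.Ioo p q) : ContinuousAt H t := by
    obtain ⟨k, hk⟩ := hcover t ht
    exact (hHc k).continuousAt (Icc_mem_nhds hk.1 hk.2)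
  have hHfac (t) (ht : t ∈ Set.Ioo p q) : H t * (H t)ᵀ = X t := by
    obtain ⟨k, hk⟩ := hcover t ht
    exact hHf k t (Set.Ioo_subset_Icc_self hk)
  have hHder (t) (ht : t ∈ Set.Ioo p q) (htC : t ∉ ⋃ k, C k) : HasDerivAt H (M t * H t) t := by
    obtain ⟨k, hk⟩ := hcover t ht
    exact hHd k t hk fun h => htC (Set.mem_iUnion.2 ⟨k, h⟩)
  have hCc : (⋃ k, C k).Countable := Set.countable_iUnion hC
  obtain ⟨G, hGc, hGH⟩ := exists_continuousOn_Icc_extension_of_bounded_deriv hpq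
    (f := H) (f' := fun t => M t * H t) (fun t ht => (hHcont t ht).continuousWithinAt)
    (fun t ht => ((hM t ht).mul (hHcont t ht)).continuousWithinAt)
    (fun t ht => hB t ht _ (hHfac t ht)) hCc hHder
  refine ⟨G, hGc, fun t ht => ?_, ⋃ k, C k, hCc, fun t ht htC => ?_⟩
  -- The factorization reaches the end points by density, both sides being continuous on the closed
  -- interval.
  · have hcl : Set.EqOn (fun t => G t * (G t)ᵀ) X (closure (Set.Ioo p q)) := by
      have hG' : ContinuousOn G (closure (Set.Ioo p q)) := by rwa [closure_Ioo hpq.ne]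
      refine Set.EqOn.of_subset_closure (fun t ht => ?_) (hG'.mul ?_) hXc.continuousOn
        subset_closure subset_rfl
      · simp only [hGH ht, hHfac t ht]
      · exact Continuous.comp_continuousOn' (by fun_prop) hG'
    rw [closure_Ioo hpq.ne] at hcl
    exact hcl ht
  · rw [hGH ht]
    refine (hHder t ht htC).congr_of_eventuallyEq ?_
    filter_upwards [Ioo_mem_nhds ht.1 ht.2] with s hs using hGH hs

end Factorization

/-! ### Locally finite break points and equations in integrated form. -/

section PiecewiseRegularity

theorem LocallyFiniteTimes.eventually_notMem {D : Set ℝ} (hD : LocallyFiniteTimes D) (t : ℝ) :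
    ∀ᶠ s in 𝓝[≠] t, s ∉ D := by
  have hfin : ((D ∩ Set.Icc (t - 1) (t + 1)) \ {t}).Finite := (hD _ _).subset Set.sdiff_subset
  have h1 : ∀ᶠ s in 𝓝 t, s ∉ (D ∩ Set.Icc (t - 1) (t + 1)) \ {t} :=
    hfin.isClosed.isOpen_compl.mem_nhds (by simp)
  have h2 : ∀ᶠ s in 𝓝 t, s ∈ Set.Icc (t - 1) (t + 1) := Icc_mem_nhds (by linarith) (by linarith)
  filter_upwards [nhdsWithin_le_nhds h1, nhdsWithin_le_nhds h2, self_mem_nhdsWithin] with s h h' h''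
  exact fun hs => h ⟨⟨hs, h'⟩, h''⟩

theorem locallyFiniteTimes_of_eventually {P : ℝ → Prop} (h : ∀ t, ∀ᶠ s in 𝓝[≠] t, P s) :
    LocallyFiniteTimes {t | ¬ P t} := by
  intro a b
  have : ∀ s ⊆ Set.Icc a b, IsCompact s → ({t | ¬ P t} ∩ s).Finite := by
    intro s _ hs
    refine hs.induction_on (p := fun s => ({t | ¬ P t} ∩ s).Finite) (by simp)
      (fun s t hst ht => ht.subset (Set.inter_subset_inter_right _ hst))
      (fun s t hs ht => by rw [Set.inter_union_distrib_left]; exact hs.union ht) fun t _ => ?_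
    refine ⟨{s | s ≠ t → P s}, nhdsWithin_le_nhds (eventually_nhdsWithin_iff.1 (h t)), ?_⟩
    refine (Set.finite_singleton t).subset fun s hs => ?_
    by_contra hst
    exact hs.1 (hs.2 hst)
  exact this _ subset_rfl isCompact_Icc

theorem LocallyFiniteTimes.countable {D : Set ℝ} (hD : LocallyFiniteTimes D) : D.Countable := by
  have : D = ⋃ k : ℕ, D ∩ Set.Icc (-(k : ℝ)) k := by
    rw [← Set.inter_iUnion, eq_comm, Set.inter_eq_left]
    intro t _
    obtain ⟨k, hk⟩ := exists_nat_ge |t|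
    exact Set.mem_iUnion.2 ⟨k, abs_le.1 hk⟩
  rw [this]
  exact Set.countable_iUnion fun k => (hD _ _).countable

/-- In this local form, break sets of several functions combine by intersecting filters. -/
theorem piecewiseContinuous_iff {X : Type*} [TopologicalSpace X] {f : ℝ → X} :
    PiecewiseContinuous f ↔ ∀ t, ∀ᶠ s in 𝓝[≠] t, ContinuousAt f s := by
  constructor
  · rintro ⟨D, hD, hf⟩ t
    exact (hD.eventually_notMem t).mono hf
  · intro h
    exact ⟨_, locallyFiniteTimes_of_eventually h, fun t ht => not_not.1 ht⟩

theorem PiecewiseAnalytic.piecewiseContinuous {f : ℝ → ℝ} (hf : PiecewiseAnalytic f) :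
    PiecewiseContinuous f := by
  obtain ⟨D, hD, hf, -⟩ := hf
  exact ⟨D, hD, fun t ht => (hf t ht).continuousAt⟩

theorem PiecewiseAnalytic.exists_analyticAt {f : ℝ → ℝ} (hf : PiecewiseAnalytic f) (t : ℝ) :
    (∃ g, AnalyticAt ℝ g t ∧ f =ᶠ[𝓝[<] t] g) ∧ (∃ g, AnalyticAt ℝ g t ∧ f =ᶠ[𝓝[>] t] g) := by
  obtain ⟨D, -, hf, hfD⟩ := hf
  by_cases ht : t ∈ D
  · exact hfD t ht
  · exact ⟨⟨f, hf t ht, EventuallyEq.rfl⟩, ⟨f, hf t ht, EventuallyEq.rfl⟩⟩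

/-- The one-sided analytic extensions rule out poles at break points; compactness does the rest. -/
theorem PiecewiseAnalytic.exists_bound {f : ℝ → ℝ} (hf : PiecewiseAnalytic f) (a b : ℝ) :
    ∃ B, ∀ t ∈ Set.Icc a b, |f t| ≤ B := by
  refine isCompact_Icc.induction_on (p := fun s => ∃ B, ∀ t ∈ s, |f t| ≤ B) ⟨0, by simp⟩ ?_ ?_ ?_
  · rintro s t hst ⟨B, hB⟩
    exact ⟨B, fun u hu => hB u (hst hu)⟩
  · rintro s t ⟨B, hB⟩ ⟨B', hB'⟩
    refine ⟨max B B', ?_⟩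
    rintro u (hu | hu)
    · exact (hB u hu).trans (le_max_left _ _)
    · exact (hB' u hu).trans (le_max_right _ _)
  · intro t _
    have hside {g : ℝ → ℝ} (hg : AnalyticAt ℝ g t) : ∀ᶠ s in 𝓝 t, |g s| ≤ |g t| + 1 :=
      (hg.continuousAt.abs.eventually_lt_const (lt_add_one _)).mono fun _ h => h.le
    obtain ⟨⟨g, hg, hfg⟩, ⟨h, hh, hfh⟩⟩ := hf.exists_analyticAt t
    refine ⟨{s | |f s| ≤ max |f t| (max (|g t| + 1) (|h t| + 1))}, nhdsWithin_le_nhds ?_,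
      _, fun s hs => hs⟩
    have h1 := eventually_nhdsWithin_iff.1 hfg
    have h2 := eventually_nhdsWithin_iff.1 hfh
    filter_upwards [h1, h2, hside hg, hside hh] with s h1 h2 h3 h4
    rcases lt_trichotomy s t with hs | rfl | hs
    · rw [h1 hs]
      exact h3.trans ((le_max_left _ _).trans (le_max_right _ _))
    · exact le_max_left _ _
    · rw [h2 hs]
      exact h4.trans ((le_max_right _ _).trans (le_max_right _ _))

theorem PiecewiseContinuous.aestronglyMeasurable {f : ℝ → ℝ} (hf : PiecewiseContinuous f) :
    AEStronglyMeasurable f volume := by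
  obtain ⟨D, hD, hf⟩ := hf
  have hDc := hD.countable
  have h := ContinuousOn.aestronglyMeasurable (f := f) (μ := volume) (s := Dᶜ)
    (fun t ht => (hf t ht).continuousWithinAt) hDc.measurableSet.compl
  rwa [Measure.restrict_eq_self_of_ae_mem (by
    rw [ae_iff]; simpa using hDc.measure_zero volume)] at h

theorem PiecewiseContinuous.intervalIntegrable {f : ℝ → ℝ} (hf : PiecewiseContinuous f)
    {a b B : ℝ} (hB : ∀ t ∈ Set.uIcc a b, |f t| ≤ B) : IntervalIntegrable f volume a b := by
  rw [intervalIntegrable_iff]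
  have : IsFiniteMeasure (volume.restrict (Set.uIoc a b)) := ⟨by simp [Set.uIoc]⟩
  refine ⟨hf.aestronglyMeasurable.restrict, HasFiniteIntegral.of_bounded (C := B) ?_⟩
  filter_upwards [ae_restrict_mem measurableSet_uIoc] with t ht
  exact hB t (Set.uIoc_subset_uIcc ht)

theorem PiecewiseContinuous.comp_continuous {X Y : Type*} [TopologicalSpace X] [TopologicalSpace Y]
    {f : ℝ → X} (hf : PiecewiseContinuous f) {φ : X → Y} (hφ : Continuous φ) :
    PiecewiseContinuous fun t => φ (f t) := by
  obtain ⟨D, hD, hf⟩ := hf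
  exact ⟨D, hD, fun t ht => hφ.continuousAt.comp (hf t ht)⟩

theorem PiecewiseContinuous.prodMk {X Y : Type*} [TopologicalSpace X] [TopologicalSpace Y]
    {f : ℝ → X} {g : ℝ → Y} (hf : PiecewiseContinuous f) (hg : PiecewiseContinuous g) :
    PiecewiseContinuous fun t => (f t, g t) := by
  rw [piecewiseContinuous_iff] at *
  intro t
  filter_upwards [hf t, hg t] with s h1 h2 using h1.prodMk h2

theorem Continuous.piecewiseContinuous {X : Type*} [TopologicalSpace X] {f : ℝ → X}
    (hf : Continuous f) : PiecewiseContinuous f :=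
  piecewiseContinuous_iff.2 fun _ => Eventually.of_forall fun _ => hf.continuousAt

theorem continuous_of_sub_eq_integral {f g : ℝ → ℝ}
    (h : ∀ t₀ t, IntervalIntegrable g volume t₀ t ∧ f t - f t₀ = ∫ τ in t₀..t, g τ) :
    Continuous f := by
  have hf : f = fun t => f 0 + ∫ τ in (0 : ℝ)..t, g τ := by
    ext t; rw [← (h 0 t).2]; ring
  rw [hf]
  exact continuous_const.add (intervalIntegral.continuous_primitive (fun a b => (h a b).1) 0)

theorem PiecewiseContinuous.hasDerivAt_of_sub_eq_integral {f g : ℝ → ℝ}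
    (hg : PiecewiseContinuous g)
    (h : ∀ t₀ t, IntervalIntegrable g volume t₀ t ∧ f t - f t₀ = ∫ τ in t₀..t, g τ)
    {t : ℝ} (ht : ContinuousAt g t) : HasDerivAt f (g t) t := by
  have hf : f = fun t => f 0 + ∫ τ in (0 : ℝ)..t, g τ := by
    ext t; rw [← (h 0 t).2]; ring
  rw [hf]
  exact (intervalIntegral.integral_hasDerivAt_right (h 0 t).1
    hg.aestronglyMeasurable.stronglyMeasurableAtFilter ht).const_add (f 0)

end PiecewiseRegularity

/-! ### Piecewise continuity of the gain. -/

section Gain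

theorem Matrix.charpoly_coeff_eq_eval {n : ℕ} (M : Matrix (Fin n) (Fin n) ℝ) (k : ℕ) :
    M.charpoly.coeff k =
      MvPolynomial.eval (fun p : Fin n × Fin n => M p.1 p.2)
        ((Matrix.charpoly.univ ℝ (Fin n)).coeff k) :=
  (Matrix.charpoly.univ_coeff_eval₂Hom (Fin n) (RingHom.id ℝ) (fun p => M p.1 p.2) k).symm

theorem Matrix.continuous_charpoly_coeff {n : ℕ} (k : ℕ) :
    Continuous fun M : Matrix (Fin n) (Fin n) ℝ => M.charpoly.coeff k := by
  simp only [Matrix.charpoly_coeff_eq_eval]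
  exact (MvPolynomial.continuous_eval _).comp (by fun_prop)

theorem AnalyticAt.charpoly_coeff {n : ℕ} {M : ℝ → Matrix (Fin n) (Fin n) ℝ} {t : ℝ}
    (hM : ∀ i j, AnalyticAt ℝ (fun t => M t i j) t) (k : ℕ) :
    AnalyticAt ℝ (fun t => (M t).charpoly.coeff k) t := by
  simp only [Matrix.charpoly_coeff_eq_eval]
  exact AnalyticAt.aeval_mvPolynomial (f := fun t (p : Fin n × Fin n) => M t p.1 p.2)
    (fun p => hM p.1 p.2) _

variable {n m : ℕ}

theorem continuousAt_gainOfOrder {r : ℕ} {Q : Matrix (Fin n ⊕ Fin m) (Fin n ⊕ Fin m) ℝ}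
    (hr : Q.toBlocks₁₁.charpoly.coeff r ≠ 0) : ContinuousAt (gainOfOrder r) Q := by
  have h11 : Continuous fun Q : Matrix (Fin n ⊕ Fin m) (Fin n ⊕ Fin m) ℝ => Q.toBlocks₁₁ :=
    continuous_matrix fun i j => (continuous_apply_apply (Sum.inl i) (Sum.inl j))
  have h21 : Continuous fun Q : Matrix (Fin n ⊕ Fin m) (Fin n ⊕ Fin m) ℝ => Q.toBlocks₂₁ :=
    continuous_matrix fun i j => (continuous_apply_apply (Sum.inr i) (Sum.inl j))
  have hc (k : ℕ) := (Matrix.continuous_charpoly_coeff (n := n) k).comp h11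
  unfold gainOfOrder
  refine ContinuousAt.smul (((hc r).continuousAt.inv₀ hr).neg) ?_
  refine (h21.matrix_mul (continuous_finsetSum _ fun k _ => ?_)).continuousAt
  exact (hc _).smul (h11.pow k)

theorem Polynomial.natTrailingDegree_eq_sInf {p : Polynomial ℝ} (hp : p ≠ 0) {S : Set ℕ}
    (hS : ∀ k, p.coeff k ≠ 0 ↔ k ∈ S) : p.natTrailingDegree = sInf S := by
  have hmem : p.natTrailingDegree ∈ S :=
    (hS _).1 (by simpa [Polynomial.trailingCoeff] using
      Polynomial.trailingCoeff_nonzero_iff_nonzero.2 hp)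
  exact le_antisymm (Polynomial.natTrailingDegree_le_of_ne_zero ((hS _).2 (Nat.sInf_mem ⟨_, hmem⟩)))
    (Nat.sInf_le hmem)

/-- The set `s` serves as one side of `t₀`. By isolated zeros, which coefficients of the
characteristic polynomial vanish is eventually constant on `s`, so `gain` agrees there with
`gainOfOrder r` for a fixed `r`. -/
theorem eventually_continuousAt_gain {Q : ℝ → Matrix (Fin n ⊕ Fin m) (Fin n ⊕ Fin m) ℝ}
    {t₀ : ℝ} {s : Set ℝ} (hs : IsOpen s) (ht₀ : t₀ ∉ s)
    (hQ : ∀ i j, ∃ g : ℝ → ℝ, AnalyticAt ℝ g t₀ ∧ (fun t => Q t i j) =ᶠ[𝓝[s] t₀] g)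
    (hQc : ∀ᶠ t in 𝓝[s] t₀, ContinuousAt Q t) :
    ∀ᶠ t in 𝓝[s] t₀, ContinuousAt (fun t => gain (Q t)) t := by
  choose g hg hQg using hQ
  let c (k : ℕ) (t : ℝ) : ℝ :=
    (Matrix.of fun i j : Fin n => g (Sum.inl i) (Sum.inl j) t).charpoly.coeff k
  have hQc' : ∀ᶠ t in 𝓝[s] t₀, ∀ k, (Q t).toBlocks₁₁.charpoly.coeff k = c k t := by
    have : ∀ᶠ t in 𝓝[s] t₀, ∀ i j, Q t i j = g i j t :=
      eventually_all.2 fun i => eventually_all.2 fun j => hQg i j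
    filter_upwards [this] with t ht k
    congr 2
    ext i j
    exact ht _ _
  have hle : 𝓝[s] t₀ ≤ 𝓝[≠] t₀ := nhdsWithin_mono _ fun t ht h => ht₀ (h ▸ ht)
  -- Bounding `k` by `n`, the degree, leaves finitely many eventual statements to combine.
  let S : Set ℕ := {k | k ≤ n ∧ ∀ᶠ t in 𝓝[s] t₀, c k t ≠ 0}
  have hS : ∀ᶠ t in 𝓝[s] t₀, ∀ k, c k t ≠ 0 ↔ k ∈ S := by
    have hfin : ∀ᶠ t in 𝓝[s] t₀, ∀ k ∈ Finset.range (n + 1), c k t ≠ 0 ↔ k ∈ S := by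
      rw [eventually_all_finset]
      intro k hk
      have hkn : k ≤ n := Nat.lt_succ_iff.1 (Finset.mem_range.1 hk)
      by_cases hkS : k ∈ S
      · filter_upwards [hkS.2] with t ht
        exact ⟨fun _ => hkS, fun _ => ht⟩
      · have han : AnalyticAt ℝ (c k) t₀ := AnalyticAt.charpoly_coeff (fun i j => hg _ _) k
        rcases han.eventually_eq_zero_or_eventually_ne_zero with h | h
        · filter_upwards [nhdsWithin_le_nhds h] with t ht
          exact ⟨fun h => absurd ht h, fun h => absurd h hkS⟩
        · exact absurd ⟨hkn, hle h⟩ hkS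
    filter_upwards [hfin] with t ht k
    by_cases hk : k ≤ n
    · exact ht k (Finset.mem_range.2 (Nat.lt_succ_of_le hk))
    · refine ⟨fun h => absurd ?_ h, fun h => absurd h.1 hk⟩
      refine Polynomial.coeff_eq_zero_of_natDegree_lt ?_
      rw [Matrix.charpoly_natDegree_eq_dim, Fintype.card_fin]
      exact not_le.1 hk
  have hr : ∀ᶠ t in 𝓝[s] t₀, (Q t).toBlocks₁₁.charpoly.natTrailingDegree = sInf S := by
    filter_upwards [hQc', hS] with t h1 h2
    exact Polynomial.natTrailingDegree_eq_sInf (Matrix.charpoly_monic _).ne_zero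
      fun k => by rw [h1, h2]
  filter_upwards [hr, eventually_eventually_nhdsWithin.2 hr, hQc, self_mem_nhdsWithin]
    with t ht ht' hct hts
  -- Since `s` is open, constancy of the order within `s` holds in a full neighbourhood of `t`.
  rw [hs.nhdsWithin_eq hts] at ht'
  have hne : (Q t).toBlocks₁₁.charpoly.coeff (sInf S) ≠ 0 := by
    rw [← ht]
    simpa [Polynomial.trailingCoeff] using
      Polynomial.trailingCoeff_nonzero_iff_nonzero.2 (Matrix.charpoly_monic _).ne_zero
  refine ContinuousAt.congr (f := fun t => gainOfOrder (sInf S) (Q t)) ?_ ?_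
  · exact (continuousAt_gainOfOrder hne).comp hct
  · filter_upwards [ht'] with u hu
    rw [gain, hu]

theorem piecewiseContinuous_of_entries {p q : Type*} [Finite p] [Finite q]
    {Q : ℝ → Matrix p q ℝ} (h : ∀ i j, PiecewiseContinuous fun t => Q t i j) :
    PiecewiseContinuous Q := by
  simp only [piecewiseContinuous_iff] at h ⊢
  intro t
  have : ∀ᶠ s in 𝓝[≠] t, ∀ i j, ContinuousAt (fun t => Q t i j) s :=
    eventually_all.2 fun i => eventually_all.2 fun j => h i j t
  filter_upwards [this] with s hs
  exact continuousAt_pi.2 fun i => continuousAt_pi.2 fun j => hs i j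

theorem piecewiseContinuous_gain {Q : ℝ → Matrix (Fin n ⊕ Fin m) (Fin n ⊕ Fin m) ℝ}
    (hQ : ∀ i j, PiecewiseAnalytic fun t => Q t i j) :
    PiecewiseContinuous fun t => gain (Q t) := by
  have hc := piecewiseContinuous_of_entries fun i j => (hQ i j).piecewiseContinuous
  rw [piecewiseContinuous_iff] at hc ⊢
  intro t
  have hct := hc t
  rw [← nhdsLT_sup_nhdsGT, eventually_sup] at hct ⊢
  exact ⟨eventually_continuousAt_gain isOpen_Iio (lt_irrefl t)
      (fun i j => ((hQ i j).exists_analyticAt t).1) hct.1,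
    eventually_continuousAt_gain isOpen_Ioi (lt_irrefl t)
      (fun i j => ((hQ i j).exists_analyticAt t).2) hct.2⟩

end Gain

/-! ### A global continuous factor across break points. -/

section

open scoped Matrix Matrix.Norms.Operator

/-- Around any `t` only `t` itself can be irregular: factors on the two sides reach `t` by the bound
`hB` and are matched there. -/
theorem exists_isFactor_of_piecewise_regular {n : ℕ} {M X : ℝ → Matrix (Fin n) (Fin n) ℝ}
    (hX : ∀ t, (X t).PosSemidef) (hXc : Continuous X)
    (hM : ∀ t, ∀ᶠ s in 𝓝[≠] t,
      ContinuousAt M s ∧ HasDerivAt X (M s * X s + X s * (M s)ᵀ) s)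
    (hB : ∀ a b, ∃ B, ∀ t ∈ Set.Icc a b, ∀ F : Matrix (Fin n) (Fin n) ℝ, F * Fᵀ = X t →
      ‖M t * F‖ ≤ B) :
    ∃ H : ℝ → Matrix (Fin n) (Fin n) ℝ, Continuous H ∧ (∀ t, H t * (H t)ᵀ = X t) ∧
      ∃ C : Set ℝ, C.Countable ∧ ∀ t, t ∉ C → HasDerivAt H (M t * H t) t := by
  obtain ⟨H, hH⟩ : ∃ H, ∀ k : ℕ, IsFactor M X H (-((k : ℝ) + 1)) (k + 1) := by
    refine exists_isFactor_of_exhaustion (a := fun k : ℕ => -((k : ℝ) + 1))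
      (b := fun k : ℕ => (k : ℝ) + 1) (fun j k h => ?_) (fun j k h => ?_)
      (fun k => ?_) fun k => ?_
    · have : (j : ℝ) ≤ k := by exact_mod_cast h
      simp only
      linarith
    · have : (j : ℝ) ≤ k := by exact_mod_cast h
      simp only
      linarith
    · have : (0 : ℝ) ≤ k := k.cast_nonneg
      linarith
    · refine exists_isFactor_Icc_of_local
        (by have : (0 : ℝ) ≤ k := k.cast_nonneg
            linarith) fun t _ => ?_
      obtain ⟨ε, hε, hreg⟩ := Metric.eventually_nhds_iff_ball.1 (eventually_nhdsWithin_iff.1 (hM t))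
      rw [Real.ball_eq_Ioo] at hreg
      have hl (s) (hs : s ∈ Set.Ioo (t - ε) t) :=
        hreg s ⟨hs.1, by linarith [hs.2]⟩ (ne_of_lt hs.2)
      have hr (s) (hs : s ∈ Set.Ioo t (t + ε)) :=
        hreg s ⟨by linarith [hs.1], hs.2⟩ (ne_of_gt hs.1)
      obtain ⟨B₁, hB₁⟩ := hB (t - ε) t
      obtain ⟨B₂, hB₂⟩ := hB t (t + ε)
      obtain ⟨H₁, h₁⟩ := exists_isFactor_of_Ioo_regular (by linarith) hX hXc
        (fun s hs => (hl s hs).1) (fun s hs => (hl s hs).2)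
        (fun s hs => hB₁ s (Set.Ioo_subset_Icc_self hs))
      obtain ⟨H₂, h₂⟩ := exists_isFactor_of_Ioo_regular (by linarith) hX hXc
        (fun s hs => (hr s hs).1) (fun s hs => (hr s hs).2)
        (fun s hs => hB₂ s (Set.Ioo_subset_Icc_self hs))
      obtain ⟨H, hH, -⟩ := h₁.exists_extend_right (by linarith) (by linarith) h₂
      exact ⟨ε, hε, H, hH⟩
  have hcover (t : ℝ) : ∃ k : ℕ, t ∈ Set.Ioo (-((k : ℝ) + 1)) (k + 1) := by
    obtain ⟨k, hk⟩ := exists_nat_ge |t|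
    exact ⟨k, abs_lt.1 (by linarith)⟩
  choose C hC hCd using fun k => (hH k).hasDerivAt
  refine ⟨H, continuous_iff_continuousAt.2 fun t => ?_, fun t => ?_, ⋃ k, C k,
    Set.countable_iUnion hC, fun t ht => ?_⟩
  · obtain ⟨k, hk⟩ := hcover t
    exact (hH k).continuousOn.continuousAt (Icc_mem_nhds hk.1 hk.2)
  · obtain ⟨k, hk⟩ := hcover t
    exact (hH k).mul_transpose t (Set.Ioo_subset_Icc_self hk)
  · obtain ⟨k, hk⟩ := hcover t
    exact hCd k t hk fun h => ht (Set.mem_iUnion.2 ⟨k, h⟩)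

end

/-! ### The two implications. -/

section MatrixDynamics

open scoped Matrix

variable {n m : ℕ}

theorem isCompact_matrix_entries_le {p q : Type*} [Finite p] [Finite q] (B : ℝ) :
    IsCompact {F : Matrix p q ℝ | ∀ i j, |F i j| ≤ B} := by
  have h : IsCompact (X := Matrix p q ℝ)
      (Set.univ.pi fun _ => Set.univ.pi fun _ => Set.Icc (-B) B) :=
    isCompact_univ_pi fun _ => isCompact_univ_pi fun _ => isCompact_Icc
  refine h.of_isClosed_subset ?_ fun F hF i _ j _ => abs_le.1 (hF i j)
  have : {F : Matrix p q ℝ | ∀ i j, |F i j| ≤ B} = ⋂ i, ⋂ j, {F | |F i j| ≤ B} := by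
    ext F; simp
  rw [this]
  exact isClosed_iInter fun i => isClosed_iInter fun j =>
    isClosed_le (continuous_id.matrix_elem i j).abs continuous_const

theorem exists_entries_bound {p q : Type*} [Finite p] [Finite q] {Q : ℝ → Matrix p q ℝ}
    (hQ : ∀ i j, PiecewiseAnalytic fun t => Q t i j) (a b : ℝ) :
    ∃ B, ∀ t ∈ Set.Icc a b, ∀ i j, |Q t i j| ≤ B := by
  choose B hB using fun i j => (hQ i j).exists_bound a b
  obtain ⟨C, hC⟩ := (Set.finite_range fun p : p × q => B p.1 p.2).bddAbove
  exact ⟨C, fun t ht i j => (hB i j t ht).trans (hC ⟨(i, j), rfl⟩)⟩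

theorem intervalIntegrable_comp_of_piecewiseAnalytic {p q : Type*} [Finite p] [Finite q]
    {Q : ℝ → Matrix p q ℝ} (hQ : ∀ i j, PiecewiseAnalytic fun t => Q t i j)
    {φ : Matrix p q ℝ → ℝ} (hφ : Continuous φ) (a b : ℝ) :
    IntervalIntegrable (fun t => φ (Q t)) volume a b := by
  obtain ⟨B, hB⟩ := exists_entries_bound hQ (min a b) (max a b)
  obtain ⟨C, hC⟩ := (isCompact_matrix_entries_le B).exists_bound_of_continuousOn hφ.continuousOn
  exact ((piecewiseContinuous_of_entries fun i j =>
    (hQ i j).piecewiseContinuous).comp_continuous hφ).intervalIntegrable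
      fun t ht => hC _ (hB t ht)

/-- The diagonal of `(K F)(K F)ᵀ = K Q₁₁ Kᵀ` is dominated by that of `Q₂₂`, so `K F` stays bounded
even where `K` does not. A general `φ` covers both the matrix `M F` and its scalar entries. -/
theorem exists_bound_of_factor {Q : ℝ → Matrix (Fin n ⊕ Fin m) (Fin n ⊕ Fin m) ℝ}
    (hpsd : ∀ t, (Q t).PosSemidef) (hQ : ∀ i j, PiecewiseAnalytic fun t => Q t i j)
    {E : Type*} [SeminormedAddCommGroup E]
    {φ : Matrix (Fin n) (Fin n) ℝ × Matrix (Fin m) (Fin n) ℝ → E} (hφ : Continuous φ)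
    (a b : ℝ) :
    ∃ B, ∀ t ∈ Set.Icc a b, ∀ F : Matrix (Fin n) (Fin n) ℝ, F * Fᵀ = (Q t).toBlocks₁₁ →
      ‖φ (F, gain (Q t) * F)‖ ≤ B := by
  obtain ⟨B, hB⟩ := exists_entries_bound hQ a b
  obtain ⟨C, hC⟩ := ((isCompact_matrix_entries_le (|B| + 1)).prod
    (isCompact_matrix_entries_le (|B| + 1))).exists_bound_of_continuousOn hφ.continuousOn
  have hsq {x : ℝ} (hx : x ^ 2 ≤ B) : |x| ≤ |B| + 1 :=
    abs_le_of_sq_le_sq (by nlinarith [le_abs_self B, abs_nonneg B]) (by positivity)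
  refine ⟨C, fun t ht F hF => hC _ ⟨fun i j => hsq ?_, fun i j => hsq ?_⟩⟩
  · exact (Matrix.sq_le_diag_of_mul_transpose_eq hF i j).trans
      ((le_abs_self _).trans (hB t ht _ _))
  · have hKF : (gain (Q t) * F) * (gain (Q t) * F)ᵀ
        = gain (Q t) * (Q t).toBlocks₁₁ * (gain (Q t))ᵀ := by
      rw [Matrix.transpose_mul, ← hF]
      simp only [Matrix.mul_assoc]
    have h1 := ((hpsd t).sub_of_mul_toBlocks₁₁_eq (hpsd t).gain_mul).diag_nonneg (i := i)
    rw [Matrix.sub_apply, sub_nonneg] at h1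
    exact (Matrix.sq_le_diag_of_mul_transpose_eq hKF i j).trans
      (h1.trans ((le_abs_self _).trans (hB t ht (Sum.inr i) (Sum.inr i))))

theorem fromCols_mul_mul_fromCols_one_zero_transpose (A : Matrix (Fin n) (Fin n) ℝ)
    (B : Matrix (Fin n) (Fin m) ℝ) (Q : Matrix (Fin n ⊕ Fin m) (Fin n ⊕ Fin m) ℝ) :
    Matrix.fromCols A B * Q *
      (Matrix.fromCols (1 : Matrix (Fin n) (Fin n) ℝ) (0 : Matrix (Fin n) (Fin m) ℝ))ᵀ
      = A * Q.toBlocks₁₁ + B * Q.toBlocks₂₁ := by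
  conv_lhs => rw [← Matrix.fromBlocks_toBlocks Q]
  simp [Matrix.transpose_fromCols, Matrix.fromCols_mul_fromBlocks, Matrix.fromCols_mul_fromRows]

theorem fromCols_one_zero_mul_mul_fromCols_transpose (A : Matrix (Fin n) (Fin n) ℝ)
    (B : Matrix (Fin n) (Fin m) ℝ) (Q : Matrix (Fin n ⊕ Fin m) (Fin n ⊕ Fin m) ℝ) :
    Matrix.fromCols (1 : Matrix (Fin n) (Fin n) ℝ) (0 : Matrix (Fin n) (Fin m) ℝ) * Q *
      (Matrix.fromCols A B)ᵀ
      = Q.toBlocks₁₁ * Aᵀ + Q.toBlocks₁₂ * Bᵀ := by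
  conv_lhs => rw [← Matrix.fromBlocks_toBlocks Q]
  simp [Matrix.transpose_fromCols, Matrix.fromCols_mul_fromBlocks, Matrix.fromCols_mul_fromRows]

theorem satisfiesMatrixDynamics_iff {A : Matrix (Fin n) (Fin n) ℝ}
    {B : Matrix (Fin n) (Fin m) ℝ} {Q : ℝ → Matrix (Fin n ⊕ Fin m) (Fin n ⊕ Fin m) ℝ} :
    SatisfiesMatrixDynamics A B Q ↔ SolvesODE (ι := Fin n × Fin n)
      (fun M k => M.toBlocks₁₁ k.1 k.2)
      (fun M k => (A * M.toBlocks₁₁ + B * M.toBlocks₂₁ +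
        (M.toBlocks₁₁ * Aᵀ + M.toBlocks₁₂ * Bᵀ)) k.1 k.2) Q := by
  simp only [SatisfiesMatrixDynamics, Matrix.one_mul, Matrix.zero_mul, add_zero,
    fromCols_mul_mul_fromCols_one_zero_transpose, fromCols_one_zero_mul_mul_fromCols_transpose]

theorem continuous_matrixDynamics_rhs (A : Matrix (Fin n) (Fin n) ℝ)
    (B : Matrix (Fin n) (Fin m) ℝ) (k : Fin n × Fin n) :
    Continuous fun M : Matrix (Fin n ⊕ Fin m) (Fin n ⊕ Fin m) ℝ =>
      (A * M.toBlocks₁₁ + B * M.toBlocks₂₁ +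
        (M.toBlocks₁₁ * Aᵀ + M.toBlocks₁₂ * Bᵀ)) k.1 k.2 := by
  have h11 : Continuous fun Q : Matrix (Fin n ⊕ Fin m) (Fin n ⊕ Fin m) ℝ => Q.toBlocks₁₁ :=
    continuous_matrix fun i j => (continuous_apply_apply (Sum.inl i) (Sum.inl j))
  have h21 : Continuous fun Q : Matrix (Fin n ⊕ Fin m) (Fin n ⊕ Fin m) ℝ => Q.toBlocks₂₁ :=
    continuous_matrix fun i j => (continuous_apply_apply (Sum.inr i) (Sum.inl j))
  have h12 : Continuous fun Q : Matrix (Fin n ⊕ Fin m) (Fin n ⊕ Fin m) ℝ => Q.toBlocks₁₂ :=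
    continuous_matrix fun i j => (continuous_apply_apply (Sum.inl i) (Sum.inr j))
  exact Continuous.matrix_elem (((continuous_const.matrix_mul h11).add
    (continuous_const.matrix_mul h21)).add ((h11.matrix_mul continuous_const).add
    (h12.matrix_mul continuous_const))) k.1 k.2

theorem SatisfiesLTI.continuous {A : Matrix (Fin n) (Fin n) ℝ} {B : Matrix (Fin n) (Fin m) ℝ}
    {x : ℝ → Fin n → ℝ} {u : ℝ → Fin m → ℝ} (h : SatisfiesLTI A B x u) (k : Fin n) :
    Continuous fun t => x t k :=
  continuous_of_sub_eq_integral (h.2 k)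

theorem SatisfiesLTI.eventually_hasDerivAt {A : Matrix (Fin n) (Fin n) ℝ}
    {B : Matrix (Fin n) (Fin m) ℝ} {x : ℝ → Fin n → ℝ} {u : ℝ → Fin m → ℝ}
    (h : SatisfiesLTI A B x u) (t : ℝ) :
    ∀ᶠ s in 𝓝[≠] t, ∀ k, HasDerivAt (fun t => x t k) ((A *ᵥ x s + B *ᵥ u s) k) s := by
  have hφ (k : Fin n) : Continuous fun z : (Fin n → ℝ) × (Fin m → ℝ) =>
      (A *ᵥ z.1 + B *ᵥ z.2) k :=
    (continuous_apply k).comp ((continuous_const.matrix_mulVec continuous_fst).add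
      (continuous_const.matrix_mulVec continuous_snd))
  filter_upwards [piecewiseContinuous_iff.1 h.1 t] with s hs k
  exact (h.1.comp_continuous (hφ k)).hasDerivAt_of_sub_eq_integral (h.2 k)
    ((hφ k).continuousAt.comp hs)

/-- Product rule for `∑ xᵢ xᵢᵀ`; the terms with zero state only contribute to `Q₂₂`, which the
equation does not involve. -/
theorem satisfiesMatrixDynamics_of_decomposition {A : Matrix (Fin n) (Fin n) ℝ}
    {B : Matrix (Fin n) (Fin m) ℝ} {Q : ℝ → Matrix (Fin n ⊕ Fin m) (Fin n ⊕ Fin m) ℝ}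
    (hQ : ∀ i j, PiecewiseAnalytic fun t => Q t i j)
    {x : Fin n ⊕ Fin m → ℝ → Fin n → ℝ} {u : Fin n ⊕ Fin m → ℝ → Fin m → ℝ}
    (hsum : ∀ t, Q t = ∑ i, Matrix.vecMulVec (Sum.elim (x i t) (u i t))
      (Sum.elim (x i t) (u i t)))
    (hlti : ∀ i : Fin n, SatisfiesLTI A B (x (Sum.inl i)) (u (Sum.inl i)))
    (hzero : ∀ j : Fin m, ∀ t, x (Sum.inr j) t = 0) :
    SatisfiesMatrixDynamics A B Q := by
  rw [satisfiesMatrixDynamics_iff]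
  have hent (t : ℝ) (a b) : Q t a b = ∑ i, Sum.elim (x i t) (u i t) a *
      Sum.elim (x i t) (u i t) b := by
    rw [hsum t, Matrix.sum_apply]
    rfl
  have h11 (t : ℝ) (a b) : (Q t).toBlocks₁₁ a b =
      ∑ i : Fin n, x (Sum.inl i) t a * x (Sum.inl i) t b := by
    simp [Matrix.toBlocks₁₁, hent, Fintype.sum_sum_type, hzero]
  have h21 (t : ℝ) (a b) : (Q t).toBlocks₂₁ a b =
      ∑ i : Fin n, u (Sum.inl i) t a * x (Sum.inl i) t b := by
    simp [Matrix.toBlocks₂₁, hent, Fintype.sum_sum_type, hzero]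
  have h12 (t : ℝ) (a b) : (Q t).toBlocks₁₂ a b =
      ∑ i : Fin n, x (Sum.inl i) t a * u (Sum.inl i) t b := by
    simp [Matrix.toBlocks₁₂, hent, Fintype.sum_sum_type, hzero]
  have hrhs (t : ℝ) (a b) : (A * (Q t).toBlocks₁₁ + B * (Q t).toBlocks₂₁ +
        ((Q t).toBlocks₁₁ * Aᵀ + (Q t).toBlocks₁₂ * Bᵀ)) a b =
      ∑ i : Fin n, ((A *ᵥ x (Sum.inl i) t + B *ᵥ u (Sum.inl i) t) a * x (Sum.inl i) t b +
        x (Sum.inl i) t a * (A *ᵥ x (Sum.inl i) t + B *ᵥ u (Sum.inl i) t) b) := by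
    simp only [Matrix.add_apply, Matrix.mul_apply, h11, h21, h12, Matrix.transpose_apply,
      Pi.add_apply, Matrix.mulVec, dotProduct, add_mul, mul_add, Finset.sum_add_distrib,
      Finset.sum_mul, Finset.mul_sum]
    congr 2
    · rw [Finset.sum_comm]; simp only [mul_assoc]
    · rw [Finset.sum_comm]; simp only [mul_assoc]
    · rw [Finset.sum_comm]; simp only [mul_comm, mul_left_comm]
    · rw [Finset.sum_comm]; simp only [mul_comm, mul_left_comm]
  refine ⟨piecewiseContinuous_of_entries fun i j => (hQ i j).piecewiseContinuous,
    fun k t₀ t => ?_⟩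
  have hint := intervalIntegrable_comp_of_piecewiseAnalytic hQ
    (continuous_matrixDynamics_rhs A B k) t₀ t
  refine ⟨hint, ?_⟩
  have hev (t : ℝ) : ∀ᶠ s in 𝓝[≠] t, ∀ i k, HasDerivAt (fun t => x (Sum.inl i) t k)
      ((A *ᵥ x (Sum.inl i) s + B *ᵥ u (Sum.inl i) s) k) s :=
    eventually_all.2 fun i => (hlti i).eventually_hasDerivAt t
  -- Continuity of the states lets the fundamental theorem of calculus ignore the countably many
  -- break points.
  refine (integral_eq_of_hasDerivAt_off_countable (fun t => (Q t).toBlocks₁₁ k.1 k.2) _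
    (locallyFiniteTimes_of_eventually hev).countable ?_ (fun s hs => ?_) hint).symm
  · simp only [h11]
    exact (continuous_finsetSum _ fun i _ =>
      ((hlti i).continuous k.1).mul ((hlti i).continuous k.2)).continuousOn
  · have hs' := not_not.1 hs.2
    simp only [h11, hrhs]
    exact HasDerivAt.fun_sum fun i _ => (hs' i k.1).mul (hs' i k.2)

-- Substituting `Q₂₁ = K Q₁₁` turns the dynamics into a Lyapunov equation with `M = A + B K`. The
-- integrated form makes `Q₁₁` continuous even at break points of `Q`.
open scoped Matrix.Norms.Operator in
theorem exists_factor_of_satisfiesMatrixDynamics {A : Matrix (Fin n) (Fin n) ℝ}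
    {B : Matrix (Fin n) (Fin m) ℝ} {Q : ℝ → Matrix (Fin n ⊕ Fin m) (Fin n ⊕ Fin m) ℝ}
    (hpsd : ∀ t, (Q t).PosSemidef) (hQ : ∀ i j, PiecewiseAnalytic fun t => Q t i j)
    (hdyn : SatisfiesMatrixDynamics A B Q) :
    ∃ H : ℝ → Matrix (Fin n) (Fin n) ℝ, Continuous H ∧
      (∀ t, H t * (H t)ᵀ = (Q t).toBlocks₁₁) ∧
      ∃ C : Set ℝ, C.Countable ∧ ∀ t, t ∉ C → ∀ i j,
        HasDerivAt (fun t => H t i j) ((A * H t + B * (gain (Q t) * H t)) i j) t := by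
  rw [satisfiesMatrixDynamics_iff] at hdyn
  obtain ⟨hQc, hdyn⟩ := hdyn
  have hφ := continuous_matrixDynamics_rhs A B
  have hXc : Continuous fun t => (Q t).toBlocks₁₁ :=
    continuous_matrix fun i j => continuous_of_sub_eq_integral (hdyn (i, j))
  have hrhs (t : ℝ) : A * (Q t).toBlocks₁₁ + B * (Q t).toBlocks₂₁ +
        ((Q t).toBlocks₁₁ * Aᵀ + (Q t).toBlocks₁₂ * Bᵀ) =
      (A + B * gain (Q t)) * (Q t).toBlocks₁₁ +
        (Q t).toBlocks₁₁ * (A + B * gain (Q t))ᵀ := by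
    have hs : (Q t).toBlocks₁₁ᵀ = (Q t).toBlocks₁₁ := by
      simpa [Matrix.IsHermitian, Matrix.conjTranspose_eq_transpose_of_trivial]
        using (hpsd t).toBlocks₁₁_posSemidef.isHermitian
    rw [(hpsd t).toBlocks₁₂_eq, ← (hpsd t).gain_mul, Matrix.transpose_add, Matrix.transpose_mul,
      Matrix.transpose_mul, hs, Matrix.add_mul, Matrix.mul_add, Matrix.mul_assoc, Matrix.mul_assoc]
  have hK := piecewiseContinuous_iff.1 (piecewiseContinuous_gain hQ)
  obtain ⟨H, hHc, hHf, C, hC, hHd⟩ := exists_isFactor_of_piecewise_regular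
    (M := fun t => A + B * gain (Q t)) (X := fun t => (Q t).toBlocks₁₁)
    (fun t => (hpsd t).toBlocks₁₁_posSemidef) hXc
    (fun t => by
      filter_upwards [hK t, piecewiseContinuous_iff.1 hQc t] with s hs hsQ
      refine ⟨continuousAt_const.add ?_, ?_⟩
      · exact (Continuous.matrix_mul (continuous_const (y := B)) continuous_id).continuousAt.comp hs
      · rw [← hrhs]
        exact hasDerivAt_pi.2 fun i => hasDerivAt_pi.2 fun j =>
          (hQc.comp_continuous (hφ (i, j))).hasDerivAt_of_sub_eq_integral (hdyn (i, j))
            ((hφ (i, j)).continuousAt.comp hsQ))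
    (fun a b => by
      obtain ⟨b₀, hb₀⟩ := exists_bound_of_factor hpsd hQ
        (φ := fun p => A * p.1 + B * p.2)
        ((continuous_const.matrix_mul continuous_fst).add
          (continuous_const.matrix_mul continuous_snd)) a b
      refine ⟨b₀, fun t ht F hF => ?_⟩
      have := hb₀ t ht F hF
      rwa [← Matrix.mul_assoc, ← Matrix.add_mul] at this)
  refine ⟨H, hHc, hHf, C, hC, fun t ht i j => ?_⟩
  have := hasDerivAt_pi.1 (hasDerivAt_pi.1 (hHd t ht) i) j
  rwa [Matrix.add_mul, Matrix.mul_assoc] at this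

open scoped MatrixOrder in
theorem exists_decomposition_of_satisfiesMatrixDynamics {A : Matrix (Fin n) (Fin n) ℝ}
    {B : Matrix (Fin n) (Fin m) ℝ} {Q : ℝ → Matrix (Fin n ⊕ Fin m) (Fin n ⊕ Fin m) ℝ}
    (hpsd : ∀ t, (Q t).PosSemidef) (hQ : ∀ i j, PiecewiseAnalytic fun t => Q t i j)
    (hdyn : SatisfiesMatrixDynamics A B Q) :
    ∃ (x : Fin n ⊕ Fin m → ℝ → Fin n → ℝ) (u : Fin n ⊕ Fin m → ℝ → Fin m → ℝ),
      (∀ i, PiecewiseContinuous (x i) ∧ PiecewiseContinuous (u i)) ∧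
      (∀ t, Q t = ∑ i, Matrix.vecMulVec (Sum.elim (x i t) (u i t))
        (Sum.elim (x i t) (u i t))) ∧
      (∀ i : Fin n, SatisfiesLTI A B (x (Sum.inl i)) (u (Sum.inl i))) ∧
      (∀ j : Fin m, ∀ t, x (Sum.inr j) t = 0) := by
  obtain ⟨H, hHc, hHf, C, hC, hHd⟩ := exists_factor_of_satisfiesMatrixDynamics hpsd hQ hdyn
  have hQc : PiecewiseContinuous Q :=
    piecewiseContinuous_of_entries fun i j => (hQ i j).piecewiseContinuous
  have hKc := piecewiseContinuous_gain hQ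
  have hGc : PiecewiseContinuous fun t => gain (Q t) * H t :=
    (hKc.prodMk hHc.piecewiseContinuous).comp_continuous
      (φ := fun p => p.1 * p.2) (continuous_fst.matrix_mul continuous_snd)
  -- `R` is the part of `Q₂₂` not explained by the inputs `K H`; it needs no dynamics, so any
  -- piecewise continuous root will do.
  let R : ℝ → Matrix (Fin m) (Fin m) ℝ := fun t =>
    (Q t).toBlocks₂₂ - gain (Q t) * (Q t).toBlocks₁₁ * (gain (Q t))ᵀ
  have hRpsd (t : ℝ) : (R t).PosSemidef := (hpsd t).sub_of_mul_toBlocks₁₁_eq (hpsd t).gain_mul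
  have hRc : PiecewiseContinuous R := by
    refine (hKc.prodMk hQc).comp_continuous
      (φ := fun p => p.2.toBlocks₂₂ - p.1 * p.2.toBlocks₁₁ * p.1ᵀ) ?_
    have h11 : Continuous fun Q : Matrix (Fin n ⊕ Fin m) (Fin n ⊕ Fin m) ℝ => Q.toBlocks₁₁ :=
      continuous_matrix fun i j => (continuous_apply_apply (Sum.inl i) (Sum.inl j))
    have h22 : Continuous fun Q : Matrix (Fin n ⊕ Fin m) (Fin n ⊕ Fin m) ℝ => Q.toBlocks₂₂ :=
      continuous_matrix fun i j => (continuous_apply_apply (Sum.inr i) (Sum.inr j))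
    exact (h22.comp continuous_snd).sub ((continuous_fst.matrix_mul
      (h11.comp continuous_snd)).matrix_mul continuous_fst.matrix_transpose)
  let W : ℝ → Matrix (Fin m) (Fin m) ℝ := fun t => CFC.sqrt (R t)
  have hWW (t : ℝ) : W t * (W t)ᵀ = R t := (hRpsd t).sqrt_mul_sqrt_transpose
  have hWc : PiecewiseContinuous W := by
    obtain ⟨D, hD, hDc⟩ := hRc
    exact ⟨D, hD, fun t ht => (hDc t ht).matrix_sqrt hRpsd⟩
  have hcol {p q : Type} (j : q) : Continuous fun (F : Matrix p q ℝ) (i : p) => F i j :=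
    continuous_pi fun i => continuous_apply_apply i j
  refine ⟨Sum.elim (fun i t k => H t k i) (fun _ _ => 0),
    Sum.elim (fun i t k => (gain (Q t) * H t) k i) (fun j t k => W t k j), ?_, fun t => ?_,
    fun i => ⟨?_, fun k t₀ t => ?_⟩, fun _ _ => rfl⟩
  · rintro (i | j)
    · exact ⟨hHc.piecewiseContinuous.comp_continuous (hcol i), hGc.comp_continuous (hcol i)⟩
    · exact ⟨continuous_const.piecewiseContinuous, hWc.comp_continuous (hcol j)⟩
  · have h11 : (Q t).toBlocks₁₁ = H t * (H t)ᵀ := (hHf t).symm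
    have h21 : (Q t).toBlocks₂₁ = (gain (Q t) * H t) * (H t)ᵀ := by
      rw [Matrix.mul_assoc, hHf, (hpsd t).gain_mul]
    have h12 : (Q t).toBlocks₁₂ = H t * (gain (Q t) * H t)ᵀ := by
      rw [(hpsd t).toBlocks₁₂_eq, h21, Matrix.transpose_mul, Matrix.transpose_transpose]
    have h22 : (Q t).toBlocks₂₂ = (gain (Q t) * H t) * (gain (Q t) * H t)ᵀ + W t * (W t)ᵀ := by
      rw [hWW, Matrix.transpose_mul, Matrix.mul_assoc, ← Matrix.mul_assoc (H t), hHf,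
        ← Matrix.mul_assoc, add_sub_cancel]
    ext a b
    rw [Matrix.sum_apply, Fintype.sum_sum_type]
    rcases a with a | a <;> rcases b with b | b
    · refine (congrFun (congrFun h11 a) b).trans ?_
      rw [Matrix.mul_apply]
      simp only [Matrix.transpose_apply, Matrix.vecMulVec_apply, Sum.elim_inl, Sum.elim_inr]
      simp
    · refine (congrFun (congrFun h12 a) b).trans ?_
      rw [Matrix.mul_apply]
      simp only [Matrix.transpose_apply, Matrix.vecMulVec_apply, Sum.elim_inl, Sum.elim_inr]
      simp
    · refine (congrFun (congrFun h21 a) b).trans ?_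
      rw [Matrix.mul_apply]
      simp only [Matrix.transpose_apply, Matrix.vecMulVec_apply, Sum.elim_inl, Sum.elim_inr]
      simp
    · refine (congrFun (congrFun h22 a) b).trans ?_
      rw [Matrix.add_apply, Matrix.mul_apply, Matrix.mul_apply]
      simp only [Matrix.transpose_apply, Matrix.vecMulVec_apply, Sum.elim_inl, Sum.elim_inr]
  · exact (hHc.piecewiseContinuous.comp_continuous (hcol i)).prodMk (hGc.comp_continuous (hcol i))
  · have hφ : Continuous fun p : Matrix (Fin n) (Fin n) ℝ × Matrix (Fin m) (Fin n) ℝ =>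
        (A * p.1 + B * p.2) k i :=
      Continuous.matrix_elem ((continuous_const.matrix_mul continuous_fst).add
        (continuous_const.matrix_mul continuous_snd)) k i
    -- Integrability of `A H + B K H` is not automatic, as `K` may be unbounded; it rests on the
    -- bound for `K H`.
    obtain ⟨b₀, hb₀⟩ := exists_bound_of_factor hpsd hQ hφ (min t₀ t) (max t₀ t)
    have hint : IntervalIntegrable
        (fun τ => (A * H τ + B * (gain (Q τ) * H τ)) k i) volume t₀ t :=
      ((hHc.piecewiseContinuous.prodMk hGc).comp_continuous hφ).intervalIntegrable
        fun τ hτ => hb₀ τ hτ (H τ) (hHf τ)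
    exact ⟨hint, (integral_eq_of_hasDerivAt_off_countable (fun τ => H τ k i) _ hC
      (hHc.matrix_elem k i).continuousOn (fun s hs => hHd s hs.2 k i) hint).symm⟩

end MatrixDynamics

theorem theorem4 (n m : ℕ) (A : Matrix (Fin n) (Fin n) ℝ) (B : Matrix (Fin n) (Fin m) ℝ)
    (Q : ℝ → Matrix (Fin n ⊕ Fin m) (Fin n ⊕ Fin m) ℝ)
    (hpsd : ∀ t, (Q t).PosSemidef)
    (hQ : ∀ i j, PiecewiseAnalytic (fun t => Q t i j)) :
    SatisfiesMatrixDynamics A B Q ↔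
      ∃ (x : Fin n ⊕ Fin m → ℝ → Fin n → ℝ) (u : Fin n ⊕ Fin m → ℝ → Fin m → ℝ),
        (∀ i, PiecewiseContinuous (x i) ∧ PiecewiseContinuous (u i)) ∧
        (∀ t, Q t = ∑ i, Matrix.vecMulVec (Sum.elim (x i t) (u i t))
          (Sum.elim (x i t) (u i t))) ∧
        (∀ i : Fin n, SatisfiesLTI A B (x (Sum.inl i)) (u (Sum.inl i))) ∧
        (∀ j : Fin m, ∀ t, x (Sum.inr j) t = 0) :=
  ⟨exists_decomposition_of_satisfiesMatrixDynamics hpsd hQ,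
    fun ⟨_, _, _, hsum, hlti, hzero⟩ =>
      satisfiesMatrixDynamics_of_decomposition hQ hsum hlti hzero⟩
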